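/- **Setting.** A *symmetric channel* is a mixture of binary symmetric channels: it is given by a probability law $\nu$ on $[0,1/2]$, and when $x\in\mathbb F_2^n$ is sent, the output is $Y=(Y_1,\dots,Y_n)$ with $Y_i=(\epsilon_i,x_i\oplus w_i)$, where the pairs $(\epsilon_i,w_i)$ are i.i.d., $\epsilon_i\sim\nu$ and $w_i\sim\mathrm{Ber}(\epsilon_i)$ given $\epsilon_i$. Its capacity $C$, in bits per channel use, is the supremum over input laws of the mutual information between one input bit and its output. A binary linear code $\mathcal C\subseteq\mathbb F_2^n$ has rate $R=\dim(\mathcal C)/n$, and its restriction to $P\subseteq[n]$ has rate $\dim(\mathcal C|_P)/|P|$; its symmetry group consists of the permutations of $[n]$ that preserve $\mathcal C$. The code is a *camellia code of expansion $\delta$ and correlation $\rho$* if its symmetry group is transitive on $[n]$ and there is a collection of subsets of $[n]$ (the petals), such that every coordinate lies in some petal, and (i) the collection is invariant under the symmetry group; (ii) the restriction of the code to any petal has rate at most $R+\delta$; (iii) for all coordinates $i\ne j$ and a uniformly drawn petal $P$, $\mathbb P(j\in P\mid i\in P)\le\rho$. For $i\in[n]$ and $S\subseteq[n]$, a *maximum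 likelihood (ML) decoder* of $X_i$ from $Y_S=(Y_j)_{j\in S}$ is a measurable rule returning, for each value of $Y_S$, a bit $b$ that maximizes the likelihood of that value given $X_i=b$, for a uniformly drawn codeword $X$ (ties are broken arbitrarily; a bit that no codeword has at $i$ has likelihood $0$). For a transmitted codeword $X$ let $P_{\mathrm{loc}}=\max_{i}\mathbb P(\hat X_i(Y_{-i})\ne X_i)$ and $P_{\mathrm{bit}}=\max_i\mathbb P(\hat X_i(Y)\ne X_i)$, where $\hat X_i(Y_{-i})$ and $\hat X_i(Y)$ are ML decoders of $X_i$ from $(Y_j)_{j\ne i}$ and from $Y$ respectively. **Theorem 1.** Fix a symmetric channel of capacity $C$, and let $(\mathcal C_k)_{k\ge 0}$ be a sequence of camellia codes of rates $R_k$, expansions $\delta_k$ and correlations $\rho_k$. Suppose that there is $\gamma>0$ with $\delta_k\le C-R_k-\gamma$ for all sufficiently large $k$, and that $\rho_k\to0$. Then, for every choice of transmitted codewords $x_k\in\mathcal C_k$ and of ML decoders, $$P_{\mathrm{loc}}(\mathcal C_k)=O(\sqrt{\rho_k})\quad(k\to\infty),\qquad P_{\mathrm{loc}}(\mathcal C_k)\to0,\qquad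 P_{\mathrm{bit}}(\mathcal C_k)\to0 .$$ -/

import Mathlib

open MeasureTheory Filter Topology Asymptotics

noncomputable section

/-- Crossover probabilities `ε ∈ [0, 1/2]` of binary symmetric channels. -/
abbrev Crossover : Type := Set.Icc (0 : ℝ) (1 / 2)

/-- Output letters `(ε, X ⊕ w)` of a symmetric channel. -/
abbrev OutputLetter : Type := Crossover × ZMod 2

/-- The `Ber(ε)` probability of the noise bit `w`. -/
def flipProb (ε : Crossover) (w : ZMod 2) : ℝ :=
  if w = 0 then 1 - (ε : ℝ) else (ε : ℝ)

/-- A symmetric channel is given by the law `ν` of the crossover probability.  This is the law of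
`(ε, w)` with `ε ∼ ν` and, given `ε`, `w ∼ Ber(ε)`. -/
def noiseLaw (ν : Measure Crossover) : Measure OutputLetter :=
  (ν.prod Measure.count).withDensity fun z => ENNReal.ofReal (flipProb z.1 z.2)

/-- The law of the output letter `(ε, b ⊕ w)` when the bit `b` is sent. -/
def outputLaw (ν : Measure Crossover) (b : ZMod 2) : Measure OutputLetter :=
  (noiseLaw ν).map fun z => (z.1, b + z.2)

/-- The law of the output word when the word `x` is sent (independent uses of the channel). -/
def wordLaw (ν : Measure Crossover) {n : ℕ} (x : Fin n → ZMod 2) :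
    Measure (Fin n → OutputLetter) :=
  Measure.pi fun j => outputLaw ν (x j)

/-- The joint law of input bit and output letter when the input has law `μ`. -/
def jointLaw (ν : Measure Crossover) (μ : Measure (ZMod 2)) : Measure (ZMod 2 × OutputLetter) :=
  ∑ b : ZMod 2, μ {b} • (Measure.dirac b).prod (outputLaw ν b)

/-- The mutual information, in nats, between input and output when the input has law `μ`:
the divergence of the joint law from the product of its two marginals. -/
def mutualInfo (ν : Measure Crossover) (μ : Measure (ZMod 2)) : ENNReal :=
  InformationTheory.klDiv (jointLaw ν μ)
    ((jointLaw ν μ).fst.prod (jointLaw ν μ).snd)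

/-- The capacity, in bits per channel use: the supremum of the mutual information over all
input laws. -/
def capacity (ν : Measure Crossover) : ℝ :=
  (⨆ μ : ProbabilityMeasure (ZMod 2), mutualInfo ν μ).toReal / Real.log 2

/-- Binary linear codes of length `n`. -/
abbrev BinaryCode (n : ℕ) : Type := Submodule (ZMod 2) (Fin n → ZMod 2)

/-- The rate of a binary linear code. -/
def codeRate {n : ℕ} (C : BinaryCode n) : ℝ :=
  (Module.finrank (ZMod 2) C : ℝ) / n

/-- The restriction of a code to a set of coordinates. -/
def codeRestrict {n : ℕ} (C : BinaryCode n) (P : Finset (Fin n)) :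
    Submodule (ZMod 2) (P → ZMod 2) :=
  C.map (LinearMap.funLeft (ZMod 2) (ZMod 2) (Subtype.val : P → Fin n))

/-- The rate of the restriction of a code to a set of coordinates. -/
def restrictRate {n : ℕ} (C : BinaryCode n) (P : Finset (Fin n)) : ℝ :=
  (Module.finrank (ZMod 2) (codeRestrict C P) : ℝ) / P.card

/-- The coordinate permutations that preserve the code (its symmetry group). -/
def IsCodeSymmetry {n : ℕ} (C : BinaryCode n) (σ : Equiv.Perm (Fin n)) : Prop :=
  ∀ x : Fin n → ZMod 2, x ∘ σ ∈ C ↔ x ∈ C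

/-- Camellia codes of expansion `δ` and correlation `ρ`.  The first condition on the petals says
that the conditional probabilities `ℙ(j ∈ P | i ∈ P)` in the last one are well defined. -/
structure IsCamelliaCode {n : ℕ} (C : BinaryCode n) (δ ρ : ℝ) : Prop where
  transitive : ∀ i j : Fin n, ∃ σ, IsCodeSymmetry C σ ∧ σ i = j
  petals : ∃ petals : Finset (Finset (Fin n)),
    (∀ i, ∃ P ∈ petals, i ∈ P) ∧
    (∀ P ∈ petals, ∀ σ, IsCodeSymmetry C σ → P.map σ.toEmbedding ∈ petals) ∧
    (∀ P ∈ petals, restrictRate C P ≤ codeRate C + δ) ∧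
    ∀ i j : Fin n, i ≠ j →
      ((petals.filter fun P => i ∈ P ∧ j ∈ P).card : ℝ) / (petals.filter fun P => i ∈ P).card ≤ ρ

/-- Rules that decide on one bit from the outputs on the set `S` of coordinates. -/
abbrev BitDecoder {n : ℕ} (S : Finset (Fin n)) : Type := (S → OutputLetter) → ZMod 2

open Classical in
/-- The likelihood of the bit value `b` at coordinate `i`, given the outputs `y` on the set `S` of
coordinates: the conditional density of `Y_S` at `y` given `X_i = b` (with respect to the product of
the crossover laws and counting measures), for a uniformly drawn codeword `X`.  It is `0`
if no codeword has `b` at coordinate `i`. -/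
def bitLikelihood {n : ℕ} (C : BinaryCode n) (i : Fin n) (S : Finset (Fin n))
    (y : S → OutputLetter) (b : ZMod 2) : ℝ :=
  (∑ x : Fin n → ZMod 2 with x ∈ C ∧ x i = b, ∏ j : S, flipProb (y j).1 ((y j).2 - x j)) /
    (Finset.univ.filter fun x : Fin n → ZMod 2 => x ∈ C ∧ x i = b).card

/-- `D` is a maximum likelihood decoder of coordinate `i` from the outputs on `S`; ties may be
broken in any (measurable) way. -/
structure IsMLDecoder {n : ℕ} (C : BinaryCode n) (i : Fin n) (S : Finset (Fin n))
    (D : BitDecoder S) : Prop where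
  measurable : Measurable D
  maximal : ∀ y b, bitLikelihood C i S y b ≤ bitLikelihood C i S y (D y)

/-- The probability that `D`, applied to the outputs on `S`, does not return the bit `x i` when the
word `x` is sent. -/
def decodingError (ν : Measure Crossover) {n : ℕ} (x : Fin n → ZMod 2) (i : Fin n)
    (S : Finset (Fin n)) (D : BitDecoder S) : ℝ :=
  (wordLaw ν x).real {y | D (fun j => y j) ≠ x i}

/-- The local error probability: the largest probability of a wrong decision on a bit from the
outputs at all other coordinates. -/
def localError (ν : Measure Crossover) {n : ℕ} (x : Fin n → ZMod 2)
    (D : ∀ i : Fin n, BitDecoder ({i}ᶜ : Finset (Fin n))) : ℝ :=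
  ⨆ i, decodingError ν x i {i}ᶜ (D i)

/-- The bit-error probability: the largest probability of a wrong decision on a bit from all
outputs. -/
def bitError (ν : Measure Crossover) {n : ℕ} (x : Fin n → ZMod 2)
    (D : Fin n → BitDecoder (Finset.univ : Finset (Fin n))) : ℝ :=
  ⨆ i, decodingError ν x i Finset.univ (D i)

end

/-!
For a uniformly drawn codeword, the mutual information between the codeword and the outputs on a
petal `P` is at most `dim(C|_P)` bits.  When the rate on `P` is at most `Cap - γ`, the law of these
outputs is therefore at divergence at least `|P| γ log 2` from the output law of fair coin flips.
By the chain rule and the inequality `log (1 + t) ≤ t`, this divergence is at most the sum over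
`i ∈ P` of the energies `𝔼[𝔼[(-1)^{X_i} | Y_{P \ i}]²]` of the soft decisions on the bits of `P`
from the other outputs on `P`.  By transitivity, the average energy over the petals through any
fixed coordinate is then at least `γ log 2`.

Let each petal through `i` vote with its soft decision on `X_i`.  When the zero word is sent, the
mean of a vote is its energy, so the total of the votes of `m` petals has mean at least
`m γ log 2`; and since a coordinate `j ≠ i` influences at most `ρ m` of these votes, the Efron-Stein
decomposition bounds the variance of the total by `ρ m²`.  By Chebyshev's inequality, the sign of
the total is wrong with probability `O(ρ)`, and a maximum likelihood decoder errs at most twice as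
often, the factor `2` accounting for ties.
-/

noncomputable section

/-- Bounded measurable real functions: the class of integrands for which every integral below is
finite. -/
@[fun_prop]
structure BddMeasurable {α : Type*} [MeasurableSpace α] (F : α → ℝ) : Prop where
  measurable : Measurable F
  bounded : ∃ B, ∀ a, |F a| ≤ B

namespace BddMeasurable

variable {α β κ : Type*} [MeasurableSpace α] [MeasurableSpace β] {F G : α → ℝ}

lemma memLp (hF : BddMeasurable F) (p : ENNReal) (μ : Measure α) [IsFiniteMeasure μ] :
    MemLp F p μ :=
  let ⟨B, hB⟩ := hF.bounded
  .of_bound hF.measurable.aestronglyMeasurable B (.of_forall hB)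

lemma integrable (hF : BddMeasurable F) (μ : Measure α) [IsFiniteMeasure μ] : Integrable F μ :=
  memLp_one_iff_integrable.1 (hF.memLp 1 μ)

@[fun_prop]
lemma const (r : ℝ) : BddMeasurable fun _ : α => r := ⟨measurable_const, |r|, fun _ => le_rfl⟩

lemma comp (hF : BddMeasurable F) {g : β → α} (hg : Measurable g) :
    BddMeasurable fun b => F (g b) :=
  ⟨hF.measurable.comp hg, hF.bounded.imp fun _ hB b => hB (g b)⟩

lemma continuous_comp (hF : BddMeasurable F) {g : ℝ → ℝ} (hg : Continuous g) :
    BddMeasurable fun a => g (F a) := by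
  obtain ⟨A, hA⟩ := hF.bounded
  obtain ⟨B, hB⟩ := isCompact_Icc.exists_bound_of_continuousOn (s := Set.Icc (-A) A)
    hg.continuousOn
  exact ⟨hg.measurable.comp hF.measurable, B, fun a => hB _ (abs_le.mp (hA a))⟩

@[fun_prop]
lemma mul_log (hF : BddMeasurable F) : BddMeasurable fun a => F a * Real.log (F a) :=
  hF.continuous_comp Real.continuous_mul_log

@[fun_prop]
lemma pow (hF : BddMeasurable F) (k : ℕ) : BddMeasurable fun a => F a ^ k :=
  hF.continuous_comp (continuous_pow k)

@[fun_prop]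
lemma add (hF : BddMeasurable F) (hG : BddMeasurable G) : BddMeasurable fun a => F a + G a := by
  obtain ⟨hF, A, hA⟩ := hF
  obtain ⟨hG, B, hB⟩ := hG
  exact ⟨hF.add hG, A + B, fun a => (abs_add_le _ _).trans (add_le_add (hA a) (hB a))⟩

@[fun_prop]
lemma mul (hF : BddMeasurable F) (hG : BddMeasurable G) : BddMeasurable fun a => F a * G a := by
  obtain ⟨hF, A, hA⟩ := hF
  obtain ⟨hG, B, hB⟩ := hG
  refine ⟨hF.mul hG, A * B, fun a => ?_⟩
  rw [abs_mul]
  exact mul_le_mul (hA a) (hB a) (abs_nonneg _) ((abs_nonneg _).trans (hA a))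

@[fun_prop]
lemma sub (hF : BddMeasurable F) (hG : BddMeasurable G) : BddMeasurable fun a => F a - G a := by
  simpa only [sub_eq_add_neg, neg_one_mul] using hF.add ((const (-1)).mul hG)

@[fun_prop]
lemma sum (s : Finset κ) {F : κ → α → ℝ} (hF : ∀ k, BddMeasurable (F k)) :
    BddMeasurable fun a => ∑ k ∈ s, F k a := by
  classical
  induction s using Finset.induction_on with
  | empty => simpa using const 0
  | insert k s hk ih => simpa only [Finset.sum_insert hk] using (hF k).add ih

@[fun_prop]
lemma prod (s : Finset κ) {F : κ → α → ℝ} (hF : ∀ k, BddMeasurable (F k)) :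
    BddMeasurable fun a => ∏ k ∈ s, F k a := by
  classical
  induction s using Finset.induction_on with
  | empty => simpa using const 1
  | insert k s hk ih => simpa only [Finset.prod_insert hk] using (hF k).mul ih

end BddMeasurable

section IndependentCoordinates

variable {ι : Type*} [DecidableEq ι] {E : ι → Type*} [∀ i, MeasurableSpace (E i)]

lemma measurable_piecewise (S : Finset ι) :
    Measurable fun p : (∀ i, E i) × (∀ i, E i) => S.piecewise p.1 p.2 := by
  refine measurable_pi_lambda _ fun i => ?_
  by_cases hi : i ∈ S <;> simp only [hi, Finset.piecewise, if_true, if_false] <;> fun_prop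

variable [Fintype ι] (μ : ∀ i, Measure (E i))

/-- The conditional mean of `F`, given the coordinates in `S`, when the coordinates are independent
with laws `μ i`: the coordinates outside `S` are integrated out. -/
def condMean (S : Finset ι) (F : (∀ i, E i) → ℝ) (y : ∀ i, E i) : ℝ :=
  ∫ y', F (S.piecewise y y') ∂Measure.pi μ

variable {μ} {S S' T : Finset ι} {F H : (∀ i, E i) → ℝ}

lemma condMean_empty (F : (∀ i, E i) → ℝ) (y : ∀ i, E i) :
    condMean μ ∅ F y = ∫ y', F y' ∂Measure.pi μ := by
  simp [condMean]

lemma dependsOn_condMean (S : Finset ι) (F : (∀ i, E i) → ℝ) : DependsOn (condMean μ S F) S := by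
  intro y z h
  have hS : ∀ y', S.piecewise y y' = S.piecewise z y' := fun y' =>
    S.piecewise_congr h fun _ _ => rfl
  simp only [condMean, hS]

lemma condMean_eq_of_dependsOn (hF : DependsOn F T) (h : ∀ i ∈ T, i ∈ S ↔ i ∈ S')
    (y : ∀ i, E i) : condMean μ S F y = condMean μ S' F y := by
  refine integral_congr_ae (.of_forall fun y' => hF fun i hi => ?_)
  simp only [Finset.piecewise, h i hi]

variable [∀ i, IsProbabilityMeasure (μ i)]

lemma condMean_univ (F : (∀ i, E i) → ℝ) (y : ∀ i, E i) :
    condMean μ Finset.univ F y = F y := by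
  simp [condMean]

lemma map_piecewise_pi (S : Finset ι) :
    ((Measure.pi μ).prod (Measure.pi μ)).map (fun p => S.piecewise p.1 p.2) = Measure.pi μ := by
  refine (Measure.pi_eq fun s hs => ?_).symm
  rw [Measure.map_apply (measurable_piecewise S) (MeasurableSet.univ_pi hs)]
  have h : (fun p : (∀ i, E i) × (∀ i, E i) => S.piecewise p.1 p.2) ⁻¹' Set.univ.pi s =
      (Set.univ.pi fun i => if i ∈ S then s i else Set.univ) ×ˢ
        (Set.univ.pi fun i => if i ∈ S then Set.univ else s i) := by
    ext p
    simp only [Set.mem_preimage, Set.mem_pi, Set.mem_univ, true_imp_iff, Set.mem_prod,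
      ← forall_and]
    refine forall_congr' fun i => ?_
    by_cases hi : i ∈ S <;> simp [hi]
  rw [h, Measure.prod_prod, Measure.pi_pi, Measure.pi_pi, ← Finset.prod_mul_distrib]
  refine Finset.prod_congr rfl fun i _ => ?_
  by_cases hi : i ∈ S <;> simp [hi]

@[fun_prop]
lemma BddMeasurable.condMean (hF : BddMeasurable F) (S : Finset ι) :
    BddMeasurable (condMean μ S F) := by
  obtain ⟨B, hB⟩ := hF.bounded
  refine ⟨((hF.comp (measurable_piecewise S)).measurable.stronglyMeasurable
    |>.integral_prod_right).measurable, B, fun y => ?_⟩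
  simpa [_root_.condMean] using norm_integral_le_of_norm_le_const (μ := Measure.pi μ)
    (f := fun y' => F (S.piecewise y y')) (.of_forall fun y' => hB _)

lemma integral_condMean (hF : BddMeasurable F) (S : Finset ι) :
    ∫ y, condMean μ S F y ∂Measure.pi μ = ∫ y, F y ∂Measure.pi μ := by
  conv_rhs => rw [← map_piecewise_pi (μ := μ) S]
  rw [integral_map (measurable_piecewise S).aemeasurable hF.measurable.aestronglyMeasurable,
    integral_prod _ ((hF.comp (measurable_piecewise S)).integrable _)]
  rfl

lemma condMean_condMean (hF : BddMeasurable F) (h : S ⊆ S') (y : ∀ i, E i) :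
    condMean μ S (condMean μ S' F) y = condMean μ S F y := by
  have hm : Measurable fun z : ∀ i, E i => S.piecewise y z :=
    (measurable_piecewise S).comp measurable_prodMk_left
  conv_rhs => rw [condMean, ← integral_condMean (hF.comp hm) S']
  have hS : ∀ z z' : ∀ i, E i, S'.piecewise (S.piecewise y z) z' =
      S.piecewise y (S'.piecewise z z') := fun z z' => by
    ext i
    by_cases hi : i ∈ S
    · simp [hi, h hi]
    · by_cases hi' : i ∈ S' <;> simp [hi, hi']
  simp only [condMean, hS]

lemma condMean_sum {κ : Type*} (A : Finset κ) {F : κ → (∀ i, E i) → ℝ}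
    (hF : ∀ a, BddMeasurable (F a)) (S : Finset ι) (y : ∀ i, E i) :
    condMean μ S (fun y => ∑ a ∈ A, F a y) y = ∑ a ∈ A, condMean μ S (F a) y :=
  integral_finsetSum A fun a _ =>
    ((hF a).comp ((measurable_piecewise S).comp measurable_prodMk_left)).integrable _

lemma integral_mul_eq_integral_condMean_mul (hF : BddMeasurable F) (hH : BddMeasurable H)
    (hS : DependsOn H S) :
    ∫ y, F y * H y ∂Measure.pi μ = ∫ y, condMean μ S F y * H y ∂Measure.pi μ := by
  have hpull : ∀ y y', H (S.piecewise y y') = H y := fun y y' =>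
    hS fun i hi => Finset.piecewise_eq_of_mem _ _ _ hi
  rw [← integral_condMean (hF.mul hH) S]
  simp only [condMean, hpull, integral_mul_const]

open ProbabilityTheory

lemma variance_condMean_sub_variance_condMean (hF : BddMeasurable F) (h : S ⊆ S') :
    Var[condMean μ S' F; Measure.pi μ] - Var[condMean μ S F; Measure.pi μ] =
      ∫ y, (condMean μ S' F y - condMean μ S F y) ^ 2 ∂Measure.pi μ := by
  have horth : ∫ y, condMean μ S' F y * condMean μ S F y ∂Measure.pi μ =
      ∫ y, condMean μ S F y ^ 2 ∂Measure.pi μ := by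
    rw [integral_mul_eq_integral_condMean_mul (hF.condMean S') (hF.condMean S)
      (dependsOn_condMean S F)]
    simp only [condMean_condMean hF h, pow_two]
  have hexpand : ∀ y, (condMean μ S' F y - condMean μ S F y) ^ 2 =
      condMean μ S' F y ^ 2 - 2 * (condMean μ S' F y * condMean μ S F y) +
        condMean μ S F y ^ 2 := fun y => by ring
  rw [variance_eq_sub ((hF.condMean S').memLp 2 _), variance_eq_sub ((hF.condMean S).memLp 2 _),
    integral_condMean hF, integral_condMean hF]
  simp only [hexpand, Pi.pow_apply]
  rw [integral_add, integral_sub, integral_const_mul, horth]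
  · ring
  all_goals exact BddMeasurable.integrable (by fun_prop) _

section SumVariance

variable {κ : Type*} {A : Finset κ} {F : κ → (∀ i, E i) → ℝ} {P : κ → Finset ι} {r : ℝ}

lemma sq_condMean_insert_sub_sum_le (hF : ∀ a, BddMeasurable (F a))
    (hP : ∀ a, DependsOn (F a) (P a)) {j : ι} (hr : ((A.filter fun a => j ∈ P a).card : ℝ) ≤ r)
    (S : Finset ι) (y : ∀ i, E i) :
    (condMean μ (insert j S) (fun y => ∑ a ∈ A, F a y) y -
        condMean μ S (fun y => ∑ a ∈ A, F a y) y) ^ 2 ≤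
      r * ∑ a ∈ A, (condMean μ (insert j S) (F a) y - condMean μ S (F a) y) ^ 2 := by
  rw [condMean_sum A hF, condMean_sum A hF, ← Finset.sum_sub_distrib]
  set D : κ → ℝ := fun a => condMean μ (insert j S) (F a) y - condMean μ S (F a) y
  have hsupport : ∀ a ∈ A, D a ≠ 0 → j ∈ P a := by
    intro a _ hne
    by_contra hja
    refine hne (sub_eq_zero.2 (condMean_eq_of_dependsOn (hP a) (fun i hi => ?_) y))
    simp [ne_of_mem_of_not_mem hi hja]
  calc (∑ a ∈ A, D a) ^ 2 = (∑ a ∈ A with j ∈ P a, D a) ^ 2 := by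
        rw [← Finset.sum_filter_of_ne hsupport]
    _ ≤ (A.filter fun a => j ∈ P a).card * ∑ a ∈ A with j ∈ P a, D a ^ 2 :=
        sq_sum_le_card_mul_sum_sq
    _ ≤ r * ∑ a ∈ A with j ∈ P a, D a ^ 2 := by gcongr
    _ ≤ r * ∑ a ∈ A, D a ^ 2 := by
        have hr0 : 0 ≤ r := (Nat.cast_nonneg _).trans hr
        gcongr
        exact Finset.filter_subset _ _

lemma variance_sum_le (hF : ∀ a, BddMeasurable (F a)) (hP : ∀ a, DependsOn (F a) (P a))
    (hr : ∀ j, ((A.filter fun a => j ∈ P a).card : ℝ) ≤ r) :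
    Var[fun y => ∑ a ∈ A, F a y; Measure.pi μ] ≤ r * ∑ a ∈ A, Var[F a; Measure.pi μ] := by
  suffices h : ∀ S : Finset ι, Var[condMean μ S fun y => ∑ a ∈ A, F a y; Measure.pi μ] ≤
      r * ∑ a ∈ A, Var[condMean μ S (F a); Measure.pi μ] by
    simpa only [funext (condMean_univ _)] using h Finset.univ
  intro S
  induction S using Finset.induction_on with
  | empty => simp [funext (condMean_empty _), variance_eq_integral]
  | insert j S _ ih =>
    have hincr := integral_mono (BddMeasurable.integrable (by fun_prop) (Measure.pi μ))
      (BddMeasurable.integrable (by fun_prop) (Measure.pi μ))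
      (sq_condMean_insert_sub_sum_le (μ := μ) hF hP (hr j) S)
    rw [integral_const_mul, integral_finsetSum A fun a _ =>
      BddMeasurable.integrable (by fun_prop) _] at hincr
    simp only [← variance_condMean_sub_variance_condMean (BddMeasurable.sum A hF)
      (Finset.subset_insert j S), ← variance_condMean_sub_variance_condMean (hF _)
      (Finset.subset_insert j S), Finset.sum_sub_distrib, mul_sub] at hincr
    linarith

end SumVariance

end IndependentCoordinates

lemma integral_mul_of_dependsOn {ι : Type*} [Fintype ι] {E : ι → Type*}
    [∀ i, MeasurableSpace (E i)] {μ : ∀ i, Measure (E i)} [∀ i, IsProbabilityMeasure (μ i)]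
    {F H : (∀ i, E i) → ℝ} {S T : Finset ι} (hF : BddMeasurable F) (hH : BddMeasurable H)
    (hS : DependsOn F S) (hT : DependsOn H T) (hST : Disjoint S T) :
    ∫ y, F y * H y ∂Measure.pi μ = (∫ y, F y ∂Measure.pi μ) * ∫ y, H y ∂Measure.pi μ := by
  classical
  have hmean : ∀ y, condMean μ T F y = ∫ y', F y' ∂Measure.pi μ := fun y => by
    rw [← condMean_empty, condMean_eq_of_dependsOn hS fun i hi => ?_]
    simp [Finset.disjoint_left.1 hST hi]
  rw [integral_mul_eq_integral_condMean_mul hF hH hT]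
  simp only [hmean, integral_const_mul]

open ProbabilityTheory in
lemma measureReal_nonpos_le_variance_div_sq {Ω : Type*} [MeasurableSpace Ω] {μ : Measure Ω}
    [IsFiniteMeasure μ] {X : Ω → ℝ} (hX : MemLp X 2 μ) {m : ℝ} (hm : 0 < m)
    (hmean : m ≤ ∫ ω, X ω ∂μ) : μ.real {ω | X ω ≤ 0} ≤ Var[X; μ] / m ^ 2 := by
  have hsub : {ω | X ω ≤ 0} ⊆ {ω | m ≤ |X ω - ∫ ω, X ω ∂μ|} := fun ω hω => by
    rw [Set.mem_ofPred_eq] at hω ⊢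
    linarith [neg_le_abs (X ω - ∫ ω, X ω ∂μ)]
  refine ENNReal.toReal_le_of_le_ofReal (div_nonneg (variance_nonneg X μ) (sq_nonneg m)) ?_
  exact (measure_mono hsub).trans (meas_ge_le_variance_div_sq hX hm)

lemma sum_filter_mem_nonneg_of_transitive {α : Type*} [Finite α] [DecidableEq α]
    {petals : Finset (Finset α)} {w : Finset α → α → ℝ}
    (htrans : ∀ i j, ∃ σ : Equiv.Perm α, σ i = j ∧
      ∀ P ∈ petals, P.map σ.toEmbedding ∈ petals ∧ w (P.map σ.toEmbedding) j = w P i)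
    (hw : ∀ P ∈ petals, 0 ≤ ∑ i ∈ P, w P i) (i : α) :
    0 ≤ ∑ P ∈ petals with i ∈ P, w P i := by
  cases nonempty_fintype α
  have hconst : ∀ j, ∑ P ∈ petals with j ∈ P, w P j = ∑ P ∈ petals with i ∈ P, w P i := by
    intro j
    obtain ⟨σ, rfl, hσ⟩ := htrans i j
    have hperm : petals.map σ.finsetCongr.toEmbedding = petals := by
      refine Finset.eq_of_subset_of_card_le (fun Q hQ => ?_) (Finset.card_map _).ge
      obtain ⟨P, hP, rfl⟩ := Finset.mem_map.1 hQ
      exact (hσ P hP).1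
    conv_lhs => rw [← hperm]
    rw [Finset.filter_map, Finset.sum_map]
    refine Finset.sum_congr (by ext P; simp) fun P hP => ?_
    exact (hσ P (Finset.mem_filter.1 hP).1).2
  have hdouble : ∑ j, ∑ P ∈ petals with j ∈ P, w P j = ∑ P ∈ petals, ∑ j ∈ P, w P j :=
    Finset.sum_comm' fun j P => by simp [and_comm]
  have htotal : 0 ≤ Fintype.card α • ∑ P ∈ petals with i ∈ P, w P i := by
    rw [← Finset.card_univ, ← Finset.sum_const, ← Finset.sum_congr rfl fun j _ => hconst j, hdouble]
    exact Finset.sum_nonneg hw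
  have hcard : 0 < Fintype.card α := Fintype.card_pos_iff.2 ⟨i⟩
  rwa [nsmul_eq_mul, mul_nonneg_iff_of_pos_left (by exact_mod_cast hcard)] at htotal

section Letters

variable {ν : Measure Crossover}

lemma zmod_two_cases (b : ZMod 2) : b = 0 ∨ b = 1 := by
  revert b; decide

/-- The sign character `b ↦ (-1)^b` of a bit, through which bits enter all densities. -/
def bitSign : AddChar (ZMod 2) ℝ := AddChar.zmodChar 2 (ζ := -1) (by norm_num)

lemma bitSign_one : bitSign 1 = -1 := by
  simp [bitSign, AddChar.zmodChar_apply, ZMod.val_one]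

lemma bitSign_eq_one_or (b : ZMod 2) : bitSign b = 1 ∨ bitSign b = -1 := by
  rcases zmod_two_cases b with rfl | rfl
  · exact .inl bitSign.map_zero_eq_one
  · exact .inr bitSign_one

lemma abs_bitSign (b : ZMod 2) : |bitSign b| = 1 := by
  rcases bitSign_eq_one_or b with h | h <;> simp [h]

lemma bitSign_mul_self (b : ZMod 2) : bitSign b * bitSign b = 1 := by
  rcases bitSign_eq_one_or b with h | h <;> simp [h]

/-- The soft value `(-1)^w (1 - 2ε)` of the output letter `(ε, w)`: the conditional mean of the sign
of a fair input bit, given the letter. -/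
def softBit (z : OutputLetter) : ℝ := bitSign z.2 * (1 - 2 * (z.1 : ℝ))

lemma abs_softBit_le (z : OutputLetter) : |softBit z| ≤ 1 := by
  rw [softBit, abs_mul, abs_bitSign, one_mul, abs_le]
  have h := z.1.2
  constructor <;> linarith [h.1, h.2]

@[fun_prop]
lemma bddMeasurable_softBit : BddMeasurable softBit where
  measurable := by unfold softBit; fun_prop
  bounded := ⟨1, abs_softBit_le⟩

/-- The density of the law of the output letter when the bit `b` is sent, with respect to the law
`baseLaw` of the output letter of a fair bit. -/
def letterDensity (b : ZMod 2) (z : OutputLetter) : ℝ := 1 + bitSign b * softBit z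

lemma letterDensity_nonneg (b : ZMod 2) (z : OutputLetter) : 0 ≤ letterDensity b z := by
  have h := neg_abs_le (bitSign b * softBit z)
  rw [abs_mul, abs_bitSign, one_mul] at h
  unfold letterDensity
  linarith [abs_softBit_le z]

@[fun_prop]
lemma bddMeasurable_letterDensity (b : ZMod 2) : BddMeasurable (letterDensity b) := by
  unfold letterDensity; fun_prop

lemma flipProb_sub (z : OutputLetter) (b : ZMod 2) :
    flipProb z.1 (z.2 - b) = letterDensity b z / 2 := by
  obtain ⟨ε, w⟩ := z
  have h : (0 : ZMod 2) - 1 = 1 := by decide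
  rcases zmod_two_cases b with rfl | rfl <;> rcases zmod_two_cases w with rfl | rfl <;>
    simp [letterDensity, softBit, flipProb, bitSign_one, h] <;> ring

/-- The law of a fair bit, written as a multiple of the counting measure in order to inherit its
translation invariance. -/
def fairBit : Measure (ZMod 2) := (2⁻¹ : ENNReal) • Measure.count

instance : fairBit.IsAddLeftInvariant := by
  unfold fairBit; infer_instance

instance : IsProbabilityMeasure fairBit where
  measure_univ := by
    simp [fairBit, Measure.count_univ, ENNReal.inv_mul_cancel]

/-- The law of the output letter when a fair bit is sent: the reference measure for all output
laws. -/
def baseLaw (ν : Measure Crossover) : Measure OutputLetter := ν.prod fairBit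

instance [IsProbabilityMeasure ν] : IsProbabilityMeasure (baseLaw ν) := by
  unfold baseLaw; infer_instance

/-- The action `(ε, w) ↦ (ε, b ⊕ w)` of the bit `b` on output letters. -/
def letterShift (b : ZMod 2) : OutputLetter ≃ᵐ OutputLetter :=
  .prodCongr (.refl _) (.addLeft b)

lemma letterShift_apply (b : ZMod 2) (z : OutputLetter) : letterShift b z = (z.1, b + z.2) := rfl

lemma letterDensity_letterShift (a b : ZMod 2) (z : OutputLetter) :
    letterDensity b (letterShift a z) = letterDensity (a + b) z := by
  simp only [letterDensity, softBit, letterShift_apply, AddChar.map_add_eq_mul]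
  ring

lemma measurePreserving_letterShift_baseLaw [SFinite ν] (b : ZMod 2) :
    MeasurePreserving (letterShift b) (baseLaw ν) (baseLaw ν) :=
  (MeasurePreserving.id ν).prod (measurePreserving_add_left fairBit b)

lemma measurePreserving_letterShift_outputLaw (a b : ZMod 2) :
    MeasurePreserving (letterShift a) (outputLaw ν b) (outputLaw ν (a + b)) where
  measurable := (letterShift a).measurable
  map_eq := by
    rw [outputLaw, Measure.map_map (letterShift a).measurable (by fun_prop), outputLaw]
    congr 1
    funext z
    exact Prod.ext rfl (add_assoc a b z.2).symm

lemma integral_comp_letterDensity [SFinite ν] (F : ℝ → ℝ) (b : ZMod 2) :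
    ∫ z, F (letterDensity b z) ∂baseLaw ν = ∫ z, F (letterDensity 0 z) ∂baseLaw ν := by
  simpa only [letterDensity_letterShift, add_zero] using
    (measurePreserving_letterShift_baseLaw b).integral_comp' fun z => F (letterDensity 0 z)

variable (ν) in
lemma integral_letterDensity [IsProbabilityMeasure ν] (b : ZMod 2) :
    ∫ z, letterDensity b z ∂baseLaw ν = 1 := by
  have hint : ∀ b, Integrable (letterDensity b) (baseLaw ν) := fun b =>
    (bddMeasurable_letterDensity b).integrable _
  have hpair : ∀ z, letterDensity 0 z + letterDensity 1 z = 2 := fun z => by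
    simp only [letterDensity, AddChar.map_zero_eq_one, bitSign_one]; ring
  have hsum : ∫ z, letterDensity 0 z + letterDensity 1 z ∂baseLaw ν = 2 := by
    simp only [hpair, integral_const, probReal_univ, smul_eq_mul, one_mul]
  rw [integral_add (hint 0) (hint 1)] at hsum
  have hsymm := fun b => integral_comp_letterDensity (ν := ν) id b
  simp only [id_eq] at hsymm
  rw [hsymm 1] at hsum
  rw [hsymm b]
  linarith

lemma integral_softBit [IsProbabilityMeasure ν] : ∫ z, softBit z ∂baseLaw ν = 0 := by
  have h := integral_letterDensity ν 0
  simp only [letterDensity, AddChar.map_zero_eq_one, one_mul] at h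
  rw [integral_add (integrable_const _) (bddMeasurable_softBit.integrable _), integral_const,
    probReal_univ, one_smul] at h
  linarith

lemma map_withDensity_comp_of_measurePreserving {α β : Type*} [MeasurableSpace α]
    [MeasurableSpace β] {μ : Measure α} {μ' : Measure β} {e : α → β} (he : MeasurePreserving e μ μ')
    {g : β → ENNReal} (hg : Measurable g) :
    (μ.withDensity (g ∘ e)).map e = μ'.withDensity g := by
  ext s hs
  rw [Measure.map_apply he.measurable hs, withDensity_apply _ (he.measurable hs),
    withDensity_apply _ hs]
  exact he.setLIntegral_comp_preimage hs hg

lemma noiseLaw_eq_withDensity :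
    noiseLaw ν = (baseLaw ν).withDensity fun z => ENNReal.ofReal (letterDensity 0 z) := by
  have hflip : (fun z : OutputLetter => ENNReal.ofReal (letterDensity 0 z)) =
      (2 : ENNReal) • fun z => ENNReal.ofReal (flipProb z.1 z.2) := by
    funext z
    have h : letterDensity 0 z = 2 * flipProb z.1 z.2 := by
      rw [← sub_zero z.2, flipProb_sub, mul_div_cancel₀ _ (two_ne_zero' ℝ)]
    rw [h, ENNReal.ofReal_mul zero_le_two, ENNReal.ofReal_ofNat]
    rfl
  have hmeas : Measurable fun z : OutputLetter => ENNReal.ofReal (flipProb z.1 z.2) := by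
    have h := (bddMeasurable_letterDensity 0).measurable.div_const 2
    simp only [← flipProb_sub, sub_zero] at h
    exact h.ennreal_ofReal
  rw [hflip, withDensity_smul _ hmeas, baseLaw, fairBit, Measure.prod_smul_right,
    withDensity_smul_measure, smul_smul, ENNReal.mul_inv_cancel two_ne_zero ENNReal.ofNat_ne_top,
    one_smul, noiseLaw]

lemma outputLaw_eq_withDensity [SFinite ν] (b : ZMod 2) :
    outputLaw ν b = (baseLaw ν).withDensity fun z => ENNReal.ofReal (letterDensity b z) := by
  rw [← map_withDensity_comp_of_measurePreserving (measurePreserving_letterShift_baseLaw b)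
    (bddMeasurable_letterDensity b).measurable.ennreal_ofReal]
  simp only [Function.comp_def, letterDensity_letterShift, CharTwo.add_self_eq_zero,
    ← noiseLaw_eq_withDensity]
  rfl

lemma isProbabilityMeasure_withDensity_ofReal {α : Type*} [MeasurableSpace α] {μ : Measure α}
    {f : α → ℝ} (hf : Integrable f μ) (h0 : ∀ a, 0 ≤ f a) (h1 : ∫ a, f a ∂μ = 1) :
    IsProbabilityMeasure (μ.withDensity fun a => ENNReal.ofReal (f a)) where
  measure_univ := by
    rw [withDensity_apply _ .univ, setLIntegral_univ,
      ← ofReal_integral_eq_lintegral_ofReal hf (.of_forall h0), h1, ENNReal.ofReal_one]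

instance [IsProbabilityMeasure ν] (b : ZMod 2) : IsProbabilityMeasure (outputLaw ν b) := by
  rw [outputLaw_eq_withDensity]
  exact isProbabilityMeasure_withDensity_ofReal
    ((bddMeasurable_letterDensity b).integrable _) (letterDensity_nonneg b)
    (integral_letterDensity ν b)

end Letters

section Capacity

open InformationTheory ProbabilityTheory

lemma klDiv_prod_snd_le {α β : Type*} [MeasurableSpace α] [MeasurableSpace β]
    [StandardBorelSpace α] [Nonempty α] (J : Measure (α × β)) [IsProbabilityMeasure J]
    (q : Measure β) [IsProbabilityMeasure q] :
    klDiv J (J.fst.prod J.snd) ≤ klDiv J (J.fst.prod q) := by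
  set J' := J.map Prod.swap with hJ'
  have : IsProbabilityMeasure J' := Measure.isProbabilityMeasure_map measurable_swap.aemeasurable
  have hJ'fst : J'.fst = J.snd := Measure.fst_map_swap
  have hdisintegrate : J.snd ⊗ₘ J'.condKernel = J' := by
    rw [← hJ'fst]; exact J'.disintegrate J'.condKernel
  have hback : J'.map Prod.swap = J := by
    rw [hJ', Measure.map_map measurable_swap measurable_swap, Prod.swap_swap_eq, Measure.map_id]
  have hchain := klDiv_compProd_eq_add (μ := J.snd) (ν := q) (κ := J'.condKernel)
    (η := Kernel.const β J.fst)
  rw [Measure.compProd_const, Measure.compProd_const, hdisintegrate] at hchain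
  calc klDiv J (J.fst.prod J.snd)
      = klDiv (J'.map Prod.swap) ((J.snd.prod J.fst).map Prod.swap) := by
        rw [hback, Measure.prod_swap]
    _ ≤ klDiv J' (J.snd.prod J.fst) := klDiv_map_le _ _ measurable_swap
    _ ≤ klDiv J' (q.prod J.fst) := by rw [hchain]; exact le_add_self
    _ = klDiv J' ((J.fst.prod q).map Prod.swap) := by rw [Measure.prod_swap]
    _ ≤ klDiv J (J.fst.prod q) := klDiv_map_le _ _ measurable_swap

lemma klDiv_withDensity_ofReal {α : Type*} [MeasurableSpace α] {μ : Measure α}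
    [IsProbabilityMeasure μ] {f : α → ℝ} (hf : BddMeasurable f) (h0 : ∀ a, 0 ≤ f a)
    (h1 : ∫ a, f a ∂μ = 1) :
    klDiv (μ.withDensity fun a => ENNReal.ofReal (f a)) μ =
      ENNReal.ofReal (∫ a, f a * Real.log (f a) ∂μ) := by
  have := isProbabilityMeasure_withDensity_ofReal (hf.integrable μ) h0 h1
  have hkl : ∫ a, klFun (f a) ∂μ = ∫ a, f a * Real.log (f a) ∂μ := by
    simp only [klFun_apply]
    rw [integral_sub, integral_add, integral_const, probReal_univ, h1]
    · simp
    all_goals exact BddMeasurable.integrable (by fun_prop) _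
  rw [klDiv_eq_lintegral_klFun_of_ac (withDensity_absolutelyContinuous _ _), ← hkl,
    ofReal_integral_eq_lintegral_ofReal ((hf.continuous_comp continuous_klFun).integrable μ)
      (.of_forall fun a => klFun_nonneg (h0 a))]
  refine lintegral_congr_ae ?_
  filter_upwards [Measure.rnDeriv_withDensity μ hf.measurable.ennreal_ofReal] with a ha
  rw [ha, ENNReal.toReal_ofReal (h0 a)]

variable (ν : Measure Crossover)

/-- The mutual information, in nats, between a fair input bit and its output letter. -/
def fairInfo : ℝ := ∫ z, letterDensity 0 z * Real.log (letterDensity 0 z) ∂baseLaw ν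

variable [IsProbabilityMeasure ν] (μ : Measure (ZMod 2))

lemma fairInfo_nonneg : 0 ≤ fairInfo ν := by
  have hlog : ∀ z, letterDensity 0 z - 1 ≤ letterDensity 0 z * Real.log (letterDensity 0 z) :=
    fun z => by
      have h := klFun_nonneg (letterDensity_nonneg 0 z)
      rw [klFun_apply] at h
      linarith
  have hmean : ∫ z, letterDensity 0 z - 1 ∂baseLaw ν = 0 := by
    rw [integral_sub ((bddMeasurable_letterDensity 0).integrable _) (integrable_const _),
      integral_letterDensity]
    simp
  rw [← hmean]
  exact integral_mono (BddMeasurable.integrable (by fun_prop) _)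
    (BddMeasurable.integrable (by fun_prop) _) hlog

lemma bddMeasurable_jointDensity :
    BddMeasurable fun p : ZMod 2 × OutputLetter => letterDensity p.1 p.2 := by
  have hsign : BddMeasurable fun p : ZMod 2 × OutputLetter => bitSign p.1 :=
    ⟨by fun_prop, 1, fun p => (abs_bitSign p.1).le⟩
  have hsoft := bddMeasurable_softBit.comp (measurable_snd (α := ZMod 2))
  unfold letterDensity
  fun_prop

lemma jointLaw_eq_withDensity : jointLaw ν μ =
    (μ.prod (baseLaw ν)).withDensity fun p => ENNReal.ofReal (letterDensity p.1 p.2) := by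
  have hmeas := bddMeasurable_jointDensity.measurable.ennreal_ofReal
  refine Measure.ext_of_lintegral _ fun f hf => ?_
  rw [lintegral_withDensity_eq_lintegral_mul _ hmeas hf,
    lintegral_prod _ (hmeas.mul hf).aemeasurable, lintegral_fintype (α := ZMod 2), jointLaw,
    lintegral_finsetSum_measure]
  refine Finset.sum_congr rfl fun b _ => ?_
  rw [lintegral_smul_measure, lintegral_prod _ hf.aemeasurable, lintegral_dirac,
    outputLaw_eq_withDensity, lintegral_withDensity_eq_lintegral_mul _
      (bddMeasurable_letterDensity b).measurable.ennreal_ofReal (by fun_prop), smul_eq_mul,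
    mul_comm]
  rfl

lemma fst_jointLaw : (jointLaw ν μ).fst = μ := by
  ext s hs
  have hterm : ∀ b, (μ {b} • (Measure.dirac b).prod (outputLaw ν b)) (Prod.fst ⁻¹' s) =
      s.indicator 1 b * μ {b} := fun b => by
    rw [Measure.smul_apply, ← Set.prod_univ, Measure.prod_prod, measure_univ, mul_one,
      Measure.dirac_apply' _ hs, smul_eq_mul, mul_comm]
  rw [Measure.fst_apply hs, jointLaw, Measure.finsetSum_apply]
  simp_rw [hterm]
  rw [← lintegral_fintype, lintegral_indicator_one hs]

variable [IsProbabilityMeasure μ]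

instance : IsProbabilityMeasure (jointLaw ν μ) where
  measure_univ := by rw [← Measure.fst_univ, fst_jointLaw, measure_univ]

lemma mutualInfo_le : mutualInfo ν μ ≤ ENNReal.ofReal (fairInfo ν) := by
  have hbdd := bddMeasurable_jointDensity
  refine (klDiv_prod_snd_le (jointLaw ν μ) (baseLaw ν)).trans_eq ?_
  rw [fst_jointLaw, jointLaw_eq_withDensity, klDiv_withDensity_ofReal hbdd
    (fun p => letterDensity_nonneg p.1 p.2), integral_prod _ (hbdd.mul_log.integrable _)]
  · simp only [integral_comp_letterDensity fun t => t * Real.log t, integral_const,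
      probReal_univ, one_smul, fairInfo]
  · rw [integral_prod _ (hbdd.integrable _)]
    simp [integral_letterDensity]

lemma capacity_mul_log_two_le : capacity ν * Real.log 2 ≤ fairInfo ν := by
  have hlog : 0 < Real.log 2 := Real.log_pos one_lt_two
  rw [capacity, div_mul_cancel₀ _ hlog.ne']
  exact ENNReal.toReal_le_of_le_ofReal (fairInfo_nonneg ν) (iSup_le fun μ => mutualInfo_le ν μ)

end Capacity

open ProbabilityTheory in
lemma pi_withDensity {ι : Type*} [Fintype ι] {E : ι → Type*} [∀ i, MeasurableSpace (E i)]
    {μ : ∀ i, Measure (E i)} [∀ i, IsProbabilityMeasure (μ i)] {g : ∀ i, E i → ENNReal}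
    (hg : ∀ i, Measurable (g i)) [∀ i, SigmaFinite ((μ i).withDensity (g i))] :
    Measure.pi (fun i => (μ i).withDensity (g i)) =
      (Measure.pi μ).withDensity fun y => ∏ i, g i (y i) := by
  classical
  refine Measure.pi_eq fun s hs => ?_
  have hind : ∀ i, Measurable ((s i).indicator (g i)) := fun i => (hg i).indicator (hs i)
  have hbox : (Set.univ.pi s).indicator (fun y => ∏ i, g i (y i)) =
      fun y => ∏ i, (s i).indicator (g i) (y i) := by
    funext y
    simp only [Set.indicator_apply, Set.mem_univ_pi, Finset.prod_ite_zero, Finset.mem_univ,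
      true_imp_iff]
  have hindep : ∫⁻ y, ∏ i, (s i).indicator (g i) (y i) ∂Measure.pi μ =
      ∏ i, ∫⁻ y, (s i).indicator (g i) (y i) ∂Measure.pi μ :=
    lintegral_prod_eq_prod_lintegral_of_indepFun _ _ (iIndepFun_pi fun i => (hind i).aemeasurable)
      fun i => (hind i).comp (measurable_pi_apply i)
  rw [withDensity_apply _ (.univ_pi hs), ← lintegral_indicator (.univ_pi hs), hbox, hindep]
  refine Finset.prod_congr rfl fun i _ => ?_
  rw [(measurePreserving_eval μ i).lintegral_comp (hind i), lintegral_indicator (hs i),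
    withDensity_apply _ (hs i)]

section Words

variable {n : ℕ} {S S' : Finset (Fin n)} {j : Fin n} {G : (Fin n → OutputLetter) → ℝ}

/-- The output law of `n` independent uses of the channel with fair input bits: the reference
measure for the laws of output words. -/
abbrev wordBase (ν : Measure Crossover) (n : ℕ) : Measure (Fin n → OutputLetter) :=
  Measure.pi fun _ => baseLaw ν

/-- The density, with respect to `wordBase`, of the outputs on `S` when the word `c` is sent. -/
def wordDensity (S : Finset (Fin n)) (c : Fin n → ZMod 2) (y : Fin n → OutputLetter) : ℝ :=
  ∏ j ∈ S, letterDensity (c j) (y j)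

lemma wordDensity_nonneg (S : Finset (Fin n)) (c : Fin n → ZMod 2) (y : Fin n → OutputLetter) :
    0 ≤ wordDensity S c y :=
  Finset.prod_nonneg fun _ _ => letterDensity_nonneg _ _

lemma wordDensity_insert (hj : j ∉ S) (c : Fin n → ZMod 2) (y : Fin n → OutputLetter) :
    wordDensity (insert j S) c y = letterDensity (c j) (y j) * wordDensity S c y :=
  Finset.prod_insert hj

@[fun_prop]
lemma bddMeasurable_wordDensity (S : Finset (Fin n)) (c : Fin n → ZMod 2) :
    BddMeasurable (wordDensity S c) :=
  .prod S fun j => (bddMeasurable_letterDensity (c j)).comp (measurable_pi_apply j)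

lemma dependsOn_wordDensity (S : Finset (Fin n)) (c : Fin n → ZMod 2) :
    DependsOn (wordDensity S c) S := fun y y' h =>
  Finset.prod_congr rfl fun j hj => by rw [h j hj]

/-- The action `y ↦ a ⊕ y` of the word `a` on output words. -/
def wordShift (a : Fin n → ZMod 2) : (Fin n → OutputLetter) ≃ᵐ (Fin n → OutputLetter) :=
  .piCongrRight fun j => letterShift (a j)

lemma wordDensity_wordShift (S : Finset (Fin n)) (c a : Fin n → ZMod 2)
    (y : Fin n → OutputLetter) :
    wordDensity S c (wordShift a y) = wordDensity S (a + c) y :=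
  Finset.prod_congr rfl fun _ _ => letterDensity_letterShift _ _ _

variable {ν : Measure Crossover} [IsProbabilityMeasure ν]

lemma measurePreserving_wordShift_wordLaw (a c : Fin n → ZMod 2) :
    MeasurePreserving (wordShift a) (wordLaw ν c) (wordLaw ν (a + c)) :=
  measurePreserving_pi _ _ fun j => measurePreserving_letterShift_outputLaw (a j) (c j)

lemma integral_letter_mul {F : OutputLetter → ℝ} (hF : BddMeasurable F) (hG : BddMeasurable G)
    (hS : DependsOn G S) (hj : j ∉ S) :
    ∫ y, F (y j) * G y ∂wordBase ν n = (∫ z, F z ∂baseLaw ν) * ∫ y, G y ∂wordBase ν n := by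
  have hdep : DependsOn (fun y : Fin n → OutputLetter => F (y j)) ({j} : Finset (Fin n)) :=
    fun y y' h => congrArg F (h j (by simp))
  rw [integral_mul_of_dependsOn (hF.comp (measurable_pi_apply j)) hG hdep hS (by simpa using hj)]
  congr 1
  exact integral_comp_eval hF.measurable.aestronglyMeasurable

variable (ν) in
lemma integral_wordDensity (S : Finset (Fin n)) (c : Fin n → ZMod 2) :
    ∫ y, wordDensity S c y ∂wordBase ν n = 1 := by
  induction S using Finset.induction_on with
  | empty => simp [wordDensity]
  | insert j S hj ih =>
    simp only [wordDensity_insert hj]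
    rw [integral_letter_mul (bddMeasurable_letterDensity _) (bddMeasurable_wordDensity S c)
      (dependsOn_wordDensity S c) hj, ih, integral_letterDensity, one_mul]

lemma integral_mul_wordDensity_of_subset (hG : BddMeasurable G) (hS : DependsOn G S)
    (hSS' : S ⊆ S') (c : Fin n → ZMod 2) :
    ∫ y, G y * wordDensity S' c y ∂wordBase ν n = ∫ y, G y * wordDensity S c y ∂wordBase ν n := by
  have hsplit : ∀ y, G y * wordDensity S' c y =
      G y * wordDensity S c y * wordDensity (S' \ S) c y := fun y => by
    rw [mul_assoc, wordDensity, ← Finset.prod_sdiff hSS', mul_comm (∏ _ ∈ _, _)]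
    rfl
  have hdep : DependsOn (fun y => G y * wordDensity S c y) S := fun y y' h =>
    congrArg₂ _ (hS h) (dependsOn_wordDensity S c h)
  simp only [hsplit]
  rw [integral_mul_of_dependsOn (by fun_prop) (by fun_prop) hdep (dependsOn_wordDensity _ c)
    Finset.disjoint_sdiff, integral_wordDensity, mul_one]

lemma integral_wordDensity_mul_log (S : Finset (Fin n)) (c : Fin n → ZMod 2) :
    ∫ y, wordDensity S c y * Real.log (wordDensity S c y) ∂wordBase ν n =
      S.card * fairInfo ν := by
  induction S using Finset.induction_on with
  | empty => simp [wordDensity]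
  | insert j S hj ih =>
    have hchain : ∀ y, wordDensity (insert j S) c y * Real.log (wordDensity (insert j S) c y) =
        letterDensity (c j) (y j) * Real.log (letterDensity (c j) (y j)) * wordDensity S c y +
          letterDensity (c j) (y j) * (wordDensity S c y * Real.log (wordDensity S c y)) :=
      fun y => by
        have h := Real.negMulLog_mul (letterDensity (c j) (y j)) (wordDensity S c y)
        simp only [Real.negMulLog] at h
        rw [wordDensity_insert hj]
        linarith
    have hletter := (bddMeasurable_letterDensity (c j)).comp
      (measurable_pi_apply (X := fun _ => OutputLetter) j)
    have hdep := dependsOn_wordDensity S c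
    simp only [hchain]
    rw [integral_add (BddMeasurable.integrable (by fun_prop) _)
      (BddMeasurable.integrable (by fun_prop) _),
      integral_letter_mul (bddMeasurable_letterDensity _).mul_log (by fun_prop) hdep hj,
      integral_letter_mul (bddMeasurable_letterDensity _) (by fun_prop)
        (fun y y' h => by rw [hdep h]) hj,
      ih, integral_wordDensity, integral_letterDensity,
      integral_comp_letterDensity fun t => t * Real.log t, Finset.card_insert_of_notMem hj,
      fairInfo]
    push_cast
    ring

instance (c : Fin n → ZMod 2) : IsProbabilityMeasure (wordLaw ν c) := by
  unfold wordLaw; infer_instance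

lemma wordLaw_eq_withDensity (c : Fin n → ZMod 2) : wordLaw ν c =
    (wordBase ν n).withDensity fun y => ENNReal.ofReal (wordDensity Finset.univ c y) := by
  have hletter := fun j => outputLaw_eq_withDensity (ν := ν) (c j)
  have hfinite : ∀ j, SigmaFinite
      ((baseLaw ν).withDensity fun z => ENNReal.ofReal (letterDensity (c j) z)) := fun j =>
    hletter j ▸ inferInstance
  simp only [wordLaw, hletter]
  rw [pi_withDensity fun j => (bddMeasurable_letterDensity (c j)).measurable.ennreal_ofReal]
  simp only [wordDensity, ENNReal.ofReal_prod_of_nonneg fun j _ => letterDensity_nonneg (c j) _]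

lemma integral_wordLaw (c : Fin n → ZMod 2) (F : (Fin n → OutputLetter) → ℝ) :
    ∫ y, F y ∂wordLaw ν c = ∫ y, F y * wordDensity Finset.univ c y ∂wordBase ν n := by
  rw [wordLaw_eq_withDensity, integral_withDensity_eq_integral_toReal_smul
    (bddMeasurable_wordDensity _ c).measurable.ennreal_ofReal
    (.of_forall fun _ => ENNReal.ofReal_lt_top)]
  simp only [ENNReal.toReal_ofReal (wordDensity_nonneg _ _ _), smul_eq_mul, mul_comm]

lemma integral_wordLaw_of_dependsOn (hG : BddMeasurable G) (hS : DependsOn G S)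
    (c : Fin n → ZMod 2) :
    ∫ y, G y ∂wordLaw ν c = ∫ y, G y * wordDensity S c y ∂wordBase ν n := by
  rw [integral_wordLaw, integral_mul_wordDensity_of_subset hG hS S.subset_univ]

variable (ν) in
lemma measurePreserving_comp_perm_wordBase (σ : Equiv.Perm (Fin n)) :
    MeasurePreserving (fun y => y ∘ σ) (wordBase ν n) (wordBase ν n) :=
  measurePreserving_arrowCongr' (fun _ => baseLaw ν) (fun _ => baseLaw ν) σ.symm (.refl _)
    fun _ => .id _

end Words

open scoped BigOperators

section Expect

open Finset

variable {α κ : Type*} [MeasurableSpace α]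

@[fun_prop]
lemma BddMeasurable.expect (s : Finset κ) {F : κ → α → ℝ} (hF : ∀ k, BddMeasurable (F k)) :
    BddMeasurable fun a => 𝔼 k ∈ s, F k a := by
  simp only [expect_eq_sum_div_card, div_eq_mul_inv]
  fun_prop

lemma integral_expect {μ : Measure α} (s : Finset κ) {F : κ → α → ℝ}
    (hF : ∀ k, Integrable (F k) μ) : ∫ a, 𝔼 k ∈ s, F k a ∂μ = 𝔼 k ∈ s, ∫ a, F k a ∂μ := by
  simp only [expect_eq_sum_div_card]
  rw [integral_div, integral_finsetSum _ fun k _ => hF k]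

end Expect

instance {n : ℕ} (C : BinaryCode n) : Fintype C := .ofFinite C

section Codes

variable {n : ℕ} (C : BinaryCode n) (S : Finset (Fin n)) (i : Fin n)

/-- The mean, over a uniformly drawn codeword `c`, of `φ c` times the density of the outputs on
`S` when `c` is sent: the density of the outputs on `S` times the conditional mean of `φ`. -/
def codeAvg (φ : (Fin n → ZMod 2) → ℝ) (y : Fin n → OutputLetter) : ℝ :=
  𝔼 c : C, φ c * wordDensity S c y

/-- The density, with respect to `wordBase`, of the outputs on `S` for a uniformly drawn
codeword. -/
def codeDensity (y : Fin n → OutputLetter) : ℝ := codeAvg C S (fun _ => 1) y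

/-- The soft decision on bit `i`: the conditional mean of `(-1)^(X_i)` given the outputs on `S`,
for a uniformly drawn codeword `X`.  It is `0` where the density of the outputs on `S` vanishes. -/
def softDecision (y : Fin n → OutputLetter) : ℝ :=
  codeAvg C S (fun c => bitSign (c i)) y / codeDensity C S y

lemma codeDensity_eq_expect (y : Fin n → OutputLetter) :
    codeDensity C S y = 𝔼 c : C, wordDensity S c y := by
  simp only [codeDensity, codeAvg, one_mul]

lemma codeDensity_nonneg (y : Fin n → OutputLetter) : 0 ≤ codeDensity C S y := by
  rw [codeDensity_eq_expect]
  exact Finset.expect_nonneg fun c _ => wordDensity_nonneg S c y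

lemma abs_codeAvg_bitSign_le (y : Fin n → OutputLetter) :
    |codeAvg C S (fun c => bitSign (c i)) y| ≤ codeDensity C S y := by
  refine (Finset.abs_expect_le _ _).trans_eq ?_
  simp only [codeDensity_eq_expect, abs_mul, abs_bitSign, one_mul,
    abs_of_nonneg (wordDensity_nonneg S _ y)]

lemma abs_softDecision_le (y : Fin n → OutputLetter) : |softDecision C S i y| ≤ 1 := by
  rw [softDecision, abs_div, abs_of_nonneg (codeDensity_nonneg C S y)]
  exact div_le_one_of_le₀ (abs_codeAvg_bitSign_le C S i y) (codeDensity_nonneg C S y)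

lemma softDecision_mul_codeDensity (y : Fin n → OutputLetter) :
    softDecision C S i y * codeDensity C S y = codeAvg C S (fun c => bitSign (c i)) y := by
  refine div_mul_cancel_of_imp fun h => ?_
  simpa [h] using abs_codeAvg_bitSign_le C S i y

@[fun_prop]
lemma bddMeasurable_codeAvg (φ : (Fin n → ZMod 2) → ℝ) : BddMeasurable (codeAvg C S φ) := by
  unfold codeAvg; fun_prop

@[fun_prop]
lemma bddMeasurable_codeDensity : BddMeasurable (codeDensity C S) :=
  bddMeasurable_codeAvg C S fun _ => 1

@[fun_prop]
lemma bddMeasurable_softDecision : BddMeasurable (softDecision C S i) :=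
  ⟨(bddMeasurable_codeAvg C S _).measurable.div (bddMeasurable_codeDensity C S).measurable, 1,
    abs_softDecision_le C S i⟩

lemma dependsOn_codeAvg (φ : (Fin n → ZMod 2) → ℝ) : DependsOn (codeAvg C S φ) S :=
  fun y y' h => by simp only [codeAvg, dependsOn_wordDensity S _ h]

lemma dependsOn_codeDensity : DependsOn (codeDensity C S) S := dependsOn_codeAvg C S _

lemma dependsOn_softDecision : DependsOn (softDecision C S i) S := fun y y' h => by
  simp only [softDecision, dependsOn_codeAvg C S _ h, dependsOn_codeDensity C S h]

variable {S i} {S' P : Finset (Fin n)}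

lemma codeDensity_insert (hi : i ∉ S) (y : Fin n → OutputLetter) :
    codeDensity C (insert i S) y =
      (1 + softBit (y i) * softDecision C S i y) * codeDensity C S y := by
  rw [add_mul, one_mul, mul_assoc, softDecision_mul_codeDensity]
  simp only [codeDensity_eq_expect, codeAvg, Finset.mul_expect, ← Finset.expect_add_distrib,
    wordDensity_insert hi, letterDensity]
  refine Finset.expect_congr rfl fun c _ => by ring

variable (ν : Measure Crossover)

/-- The energy of the soft decision on bit `i` from the outputs on `S`: its second moment, for a
uniformly drawn codeword. -/
def decisionEnergy (S : Finset (Fin n)) (i : Fin n) : ℝ :=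
  ∫ y, softDecision C S i y ^ 2 * codeDensity C S y ∂wordBase ν n

/-- The divergence, in nats, from the base law of the law of the outputs on `S`, for a uniformly
drawn codeword. -/
def blockInfo (S : Finset (Fin n)) : ℝ :=
  ∫ y, codeDensity C S y * Real.log (codeDensity C S y) ∂wordBase ν n

variable [IsProbabilityMeasure ν]

lemma integral_mul_codeAvg {G : (Fin n → OutputLetter) → ℝ} (hG : BddMeasurable G)
    (φ : (Fin n → ZMod 2) → ℝ) :
    ∫ y, G y * codeAvg C S φ y ∂wordBase ν n =
      𝔼 c : C, φ c * ∫ y, G y * wordDensity S c y ∂wordBase ν n := by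
  simp only [codeAvg, Finset.mul_expect, mul_left_comm (G _)]
  rw [integral_expect _ fun c => BddMeasurable.integrable (by fun_prop) _]
  simp only [integral_const_mul]

lemma integral_mul_codeAvg_of_subset {G : (Fin n → OutputLetter) → ℝ} (hG : BddMeasurable G)
    (hS : DependsOn G S) (hSS' : S ⊆ S') (φ : (Fin n → ZMod 2) → ℝ) :
    ∫ y, G y * codeAvg C S' φ y ∂wordBase ν n = ∫ y, G y * codeAvg C S φ y ∂wordBase ν n := by
  simp only [integral_mul_codeAvg C ν hG, integral_mul_wordDensity_of_subset hG hS hSS']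

lemma integral_codeDensity : ∫ y, codeDensity C S y ∂wordBase ν n = 1 := by
  simpa [integral_wordDensity, codeDensity] using
    integral_mul_codeAvg C (S := S) ν (.const 1) fun _ => 1

lemma decisionEnergy_mono (hSS' : S ⊆ S') (i : Fin n) :
    decisionEnergy C ν S i ≤ decisionEnergy C ν S' i := by
  have hdep := dependsOn_softDecision C S i
  have hcross : ∫ y, softDecision C S i y * (softDecision C S' i y * codeDensity C S' y)
      ∂wordBase ν n = decisionEnergy C ν S i := by
    simp only [softDecision_mul_codeDensity]
    rw [integral_mul_codeAvg_of_subset C ν (by fun_prop) hdep hSS']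
    simp only [← softDecision_mul_codeDensity, decisionEnergy, sq, mul_assoc]
  have hold : ∫ y, softDecision C S i y ^ 2 * codeDensity C S' y ∂wordBase ν n =
      decisionEnergy C ν S i :=
    integral_mul_codeAvg_of_subset C ν (by fun_prop) (fun y y' h => by rw [hdep h]) hSS' _
  have hsq : 0 ≤ ∫ y, codeDensity C S' y * (softDecision C S' i y - softDecision C S i y) ^ 2
      ∂wordBase ν n :=
    integral_nonneg fun y => mul_nonneg (codeDensity_nonneg C S' y) (sq_nonneg _)
  have hexpand : ∀ y,
      codeDensity C S' y * (softDecision C S' i y - softDecision C S i y) ^ 2 =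
        softDecision C S' i y ^ 2 * codeDensity C S' y -
          2 * (softDecision C S i y * (softDecision C S' i y * codeDensity C S' y)) +
          softDecision C S i y ^ 2 * codeDensity C S' y := fun y => by ring
  simp only [hexpand] at hsq
  rw [integral_add, integral_sub, integral_const_mul, hcross, hold, ← decisionEnergy] at hsq
  · linarith
  all_goals exact BddMeasurable.integrable (by fun_prop) _

lemma mul_log_one_add_mul_le {f t : ℝ} (hf : 0 ≤ f) (ht : -1 ≤ t) :
    (1 + t) * f * Real.log ((1 + t) * f) ≤ (1 + t) * (f * Real.log f) + (1 + t) * t * f := by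
  have hmul := Real.negMulLog_mul (1 + t) f
  simp only [Real.negMulLog] at hmul
  have hlog : (1 + t) * Real.log (1 + t) ≤ (1 + t) * t := by
    rcases (show 0 ≤ 1 + t by linarith).eq_or_lt with h | h
    · simp [← h]
    · exact mul_le_mul_of_nonneg_left (by linarith [Real.log_le_sub_one_of_pos h]) h.le
  linarith [mul_le_mul_of_nonneg_left hlog hf]

lemma blockInfo_insert_le (hi : i ∉ S) :
    blockInfo C ν (insert i S) ≤ blockInfo C ν S + decisionEnergy C ν S i := by
  set f := codeDensity C S with hf
  set g := softDecision C S i with hg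
  have hgf : DependsOn (fun y => g y * (f y * Real.log (f y)) + g y * f y) S := fun y y' h => by
    simp only [hf, hg, dependsOn_codeDensity C S h, dependsOn_softDecision C S i h]
  have hletter : BddMeasurable fun y : Fin n → OutputLetter => softBit (y i) :=
    bddMeasurable_softBit.comp (measurable_pi_apply i)
  have hfb : BddMeasurable f := bddMeasurable_codeDensity C S
  have hgb : BddMeasurable g := bddMeasurable_softDecision C S i
  have hpt : ∀ y, codeDensity C (insert i S) y * Real.log (codeDensity C (insert i S) y) ≤
      f y * Real.log (f y) + g y ^ 2 * f y +
        softBit (y i) * (g y * (f y * Real.log (f y)) + g y * f y) := fun y => by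
    have hu := abs_softBit_le (y i)
    have hug : |softBit (y i) * g y| ≤ 1 := by
      rw [abs_mul]; exact mul_le_one₀ hu (abs_nonneg _) (abs_softDecision_le C S i y)
    have hsq : (softBit (y i)) ^ 2 * (g y ^ 2 * f y) ≤ g y ^ 2 * f y :=
      mul_le_of_le_one_left (mul_nonneg (sq_nonneg _) (codeDensity_nonneg C S y))
        ((sq_le_one_iff_abs_le_one _).2 hu)
    have h := mul_log_one_add_mul_le (codeDensity_nonneg C S y) (neg_le_of_abs_le hug)
    rw [codeDensity_insert C hi]
    linarith
  have hmono := integral_mono (BddMeasurable.integrable (by fun_prop) (wordBase ν n))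
    (BddMeasurable.integrable (by fun_prop) (wordBase ν n)) hpt
  rw [integral_add (BddMeasurable.integrable (by fun_prop) _)
    (BddMeasurable.integrable (by fun_prop) _), integral_add
    (BddMeasurable.integrable (by fun_prop) _) (BddMeasurable.integrable (by fun_prop) _),
    integral_letter_mul bddMeasurable_softBit (by fun_prop) hgf hi, integral_softBit, zero_mul,
    add_zero] at hmono
  exact hmono

lemma blockInfo_le_sum_decisionEnergy (P : Finset (Fin n)) :
    blockInfo C ν P ≤ ∑ i ∈ P, decisionEnergy C ν (P.erase i) i := by
  suffices h : ∀ S ⊆ P, blockInfo C ν S ≤ ∑ i ∈ S, decisionEnergy C ν (P.erase i) i from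
    h P subset_rfl
  intro S
  induction S using Finset.induction_on with
  | empty => simp [blockInfo, codeDensity_eq_expect, wordDensity]
  | insert i S hi ih =>
    intro hS
    have hSP := (Finset.insert_subset_iff.1 hS).2
    rw [Finset.sum_insert hi]
    have hmono := decisionEnergy_mono C ν (Finset.subset_erase.2 ⟨hSP, hi⟩) i
    linarith [ih hSP, blockInfo_insert_le C ν hi]

lemma card_code_eq (P : Finset (Fin n)) : Nat.card C =
    2 ^ Module.finrank (ZMod 2) (codeRestrict C P) *
      Nat.card {k : C // ∀ j ∈ P, (k : Fin n → ZMod 2) j = 0} := by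
  set f : C →ₗ[ZMod 2] (P → ZMod 2) :=
    (LinearMap.funLeft (ZMod 2) (ZMod 2) (Subtype.val : P → Fin n)).comp C.subtype with hf
  have hrange : codeRestrict C P = LinearMap.range f := by
    rw [hf, LinearMap.range_comp, Submodule.range_subtype]; rfl
  have hker : Nat.card {k : C // ∀ j ∈ P, (k : Fin n → ZMod 2) j = 0} =
      Nat.card (LinearMap.ker f) :=
    Nat.card_congr <| Equiv.subtypeEquivRight fun k => by
      simp [hf, funext_iff, LinearMap.funLeft_apply]
  rw [hker, hrange, Module.natCard_eq_pow_finrank (K := ZMod 2) (V := C),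
    Module.natCard_eq_pow_finrank (K := ZMod 2) (V := LinearMap.ker f), Nat.card_zmod, ← pow_add,
    LinearMap.finrank_range_add_finrank_ker]

lemma wordDensity_le_two_pow_mul_codeDensity (c : C) (y : Fin n → OutputLetter) :
    wordDensity P c y ≤
      2 ^ Module.finrank (ZMod 2) (codeRestrict C P) * codeDensity C P y := by
  let K := {k : C // ∀ j ∈ P, (k : Fin n → ZMod 2) j = 0}
  have hK : (0 : ℝ) < Nat.card K := by
    have : Nonempty K := ⟨0, fun _ _ => rfl⟩
    exact_mod_cast Nat.card_pos
  have hcoset : ∀ k : K, wordDensity P (c + k.1 : C) y = wordDensity P c y := fun k =>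
    Finset.prod_congr rfl fun j hj => by simp [k.2 j hj]
  have hsum : Nat.card K * wordDensity P c y ≤ ∑ c' : C, wordDensity P c' y := by
    cases nonempty_fintype K
    calc Nat.card K * wordDensity P c y
        = ∑ k : K, wordDensity P (c + k.1 : C) y := by
          simp only [hcoset, Finset.sum_const, Finset.card_univ, nsmul_eq_mul,
            Nat.card_eq_fintype_card]
      _ = ∑ c' ∈ Finset.univ.map ⟨fun k : K => c + k.1,
            fun a b h => Subtype.ext (add_left_cancel h)⟩, wordDensity P c' y := by
          rw [Finset.sum_map]; rfl
      _ ≤ _ := Finset.sum_le_sum_of_subset_of_nonneg (Finset.subset_univ _)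
          fun _ _ _ => wordDensity_nonneg _ _ _
  rw [codeDensity_eq_expect, Fintype.expect_eq_sum_div_card, ← Nat.card_eq_fintype_card,
    card_code_eq C P]
  push_cast
  rw [← mul_div_assoc, mul_div_mul_left _ _ (by positivity), le_div_iff₀ hK, mul_comm]
  exact hsum

lemma le_blockInfo (P : Finset (Fin n)) :
    P.card * fairInfo ν - Module.finrank (ZMod 2) (codeRestrict C P) * Real.log 2 ≤
      blockInfo C ν P := by
  set d := Module.finrank (ZMod 2) (codeRestrict C P)
  have hword : ∀ (c : C) y, wordDensity P c y * Real.log (wordDensity P c y) -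
      d * Real.log 2 * wordDensity P c y ≤
        wordDensity P c y * Real.log (codeDensity C P y) := fun c y => by
    rcases (wordDensity_nonneg P c y).eq_or_lt with h | h
    · simp [← h]
    have hle := wordDensity_le_two_pow_mul_codeDensity (P := P) C c y
    have hpos : 0 < codeDensity C P y := pos_of_mul_pos_right (h.trans_le hle) (by positivity)
    have hlog := Real.log_le_log h hle
    rw [Real.log_mul (by positivity) hpos.ne', Real.log_pow] at hlog
    linarith [mul_le_mul_of_nonneg_left hlog h.le]
  have hcode : ∀ y, (𝔼 c : C, wordDensity P c y * Real.log (wordDensity P c y)) -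
      d * Real.log 2 * codeDensity C P y ≤
        codeDensity C P y * Real.log (codeDensity C P y) := fun y => by
    have h := Finset.expect_le_expect fun (c : C) (_ : c ∈ Finset.univ) => hword c y
    rwa [Finset.expect_sub_distrib, ← Finset.mul_expect, ← Finset.expect_mul,
      ← codeDensity_eq_expect] at h
  have hmono := integral_mono (BddMeasurable.integrable (by fun_prop) (wordBase ν n))
    (BddMeasurable.integrable (by fun_prop) (wordBase ν n)) hcode
  rw [integral_sub (BddMeasurable.integrable (by fun_prop) _)
    (BddMeasurable.integrable (by fun_prop) _), integral_const_mul, integral_codeDensity, mul_one,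
    integral_expect _ fun c => BddMeasurable.integrable (by fun_prop) _] at hmono
  rwa [← blockInfo, funext fun c : C => integral_wordDensity_mul_log P (c : Fin n → ZMod 2),
    Fintype.expect_const] at hmono

end Codes

section Equivariance

variable {n : ℕ} {C : BinaryCode n} {S : Finset (Fin n)} {i : Fin n}

/-- Statistics of the output word that, like the soft decisions on bit `i`, change by the sign of
`a i` when the output word is shifted by a codeword `a`. -/
def IsBitEquivariant (C : BinaryCode n) (i : Fin n) (T : (Fin n → OutputLetter) → ℝ) : Prop :=
  ∀ a ∈ C, ∀ y, T (wordShift a y) = bitSign (a i) * T y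

lemma codeAvg_wordShift (φ : (Fin n → ZMod 2) → ℝ) {a : Fin n → ZMod 2} (ha : a ∈ C)
    (y : Fin n → OutputLetter) :
    codeAvg C S φ (wordShift a y) = codeAvg C S (fun c => φ (a + c)) y := by
  refine Fintype.expect_equiv (Equiv.addLeft (⟨a, ha⟩ : C)) _ _ fun c => ?_
  have hcancel : a + (a + c) = (c : Fin n → ZMod 2) := by
    rw [← add_assoc, ZModModule.add_self, zero_add]
  simp only [Equiv.coe_addLeft, Submodule.coe_add, wordDensity_wordShift, hcancel]

lemma isBitEquivariant_softDecision : IsBitEquivariant C i (softDecision C S i) := fun a ha y => by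
  simp only [softDecision, codeDensity, codeAvg_wordShift _ ha, Pi.add_apply,
    AddChar.map_add_eq_mul]
  rw [← mul_div_assoc]
  simp only [codeAvg, Finset.mul_expect, mul_assoc]

lemma IsBitEquivariant.sum {κ : Type*} {s : Finset κ} {T : κ → (Fin n → OutputLetter) → ℝ}
    (hT : ∀ k, IsBitEquivariant C i (T k)) : IsBitEquivariant C i fun y => ∑ k ∈ s, T k y :=
  fun a ha y => by simp only [hT _ a ha y, Finset.mul_sum]

variable {ν : Measure Crossover} [IsProbabilityMeasure ν] {G T : (Fin n → OutputLetter) → ℝ}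

variable (C) in
lemma integral_wordLaw_zero_eq_expect (hG : BddMeasurable G) (hS : DependsOn G S) :
    ∫ y, G y ∂wordLaw ν 0 =
      𝔼 c : C, ∫ y, G (wordShift c y) * wordDensity S c y ∂wordBase ν n := by
  have hterm : ∀ c : C, ∫ y, G (wordShift c y) * wordDensity S c y ∂wordBase ν n =
      ∫ y, G y ∂wordLaw ν 0 := fun c => by
    have hdep : DependsOn (fun y => G (wordShift (c : Fin n → ZMod 2) y)) S := fun y y' h =>
      hS fun j hj => congrArg (letterShift _) (h j hj)
    rw [← integral_wordLaw_of_dependsOn (hG.comp (wordShift _).measurable) hdep,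
      (measurePreserving_wordShift_wordLaw _ _).integral_comp' G, ZModModule.add_self]
  simp only [hterm, Fintype.expect_const]

lemma IsBitEquivariant.integral_wordLaw_zero (hT : IsBitEquivariant C i T)
    (hbdd : BddMeasurable T) (hS : DependsOn T S) :
    ∫ y, T y ∂wordLaw ν 0 =
      ∫ y, T y * codeAvg C S (fun c => bitSign (c i)) y ∂wordBase ν n := by
  rw [integral_wordLaw_zero_eq_expect C hbdd hS, integral_mul_codeAvg C ν hbdd]
  refine Finset.expect_congr rfl fun c _ => ?_
  simp only [hT c c.2, mul_assoc, integral_const_mul]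

variable (C S i) in
lemma integral_softDecision :
    ∫ y, softDecision C S i y ∂wordLaw ν 0 = decisionEnergy C ν S i := by
  rw [isBitEquivariant_softDecision.integral_wordLaw_zero (bddMeasurable_softDecision C S i)
    (dependsOn_softDecision C S i)]
  simp only [← softDecision_mul_codeDensity, decisionEnergy, sq, mul_assoc]

end Equivariance

section Decoding

variable {n : ℕ} {C : BinaryCode n} {S : Finset (Fin n)} {i : Fin n}

lemma BddMeasurable.indicator_one {α : Type*} [MeasurableSpace α] {s : Set α}
    (hs : MeasurableSet s) : BddMeasurable (s.indicator (1 : α → ℝ)) :=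
  ⟨measurable_one.indicator hs, 1, fun a => by
    by_cases h : a ∈ s <;> simp [h]⟩

variable {ν : Measure Crossover} [IsProbabilityMeasure ν] {T : (Fin n → OutputLetter) → ℝ}

lemma IsBitEquivariant.two_mul_measureReal_nonpos (hT : IsBitEquivariant C i T)
    (hm : Measurable T) (hS : DependsOn T S) :
    2 * (wordLaw ν 0).real {y | T y ≤ 0} =
      ∫ y, {y | T y ≤ 0}.indicator 1 y *
          (codeDensity C S y + codeAvg C S (fun c => bitSign (c i)) y) +
        {y | 0 ≤ T y}.indicator 1 y *
          (codeDensity C S y - codeAvg C S (fun c => bitSign (c i)) y) ∂wordBase ν n := by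
  have hneg : MeasurableSet {y | T y ≤ 0} := hm measurableSet_Iic
  have hpos : MeasurableSet {y | 0 ≤ T y} := hm measurableSet_Ici
  have hN := BddMeasurable.indicator_one hneg
  have hP := BddMeasurable.indicator_one hpos
  set N : (Fin n → OutputLetter) → ℝ := {y | T y ≤ 0}.indicator 1 with hN_eq
  set P : (Fin n → OutputLetter) → ℝ := {y | 0 ≤ T y}.indicator 1 with hP_eq
  have hdep : DependsOn N S := fun y y' h => by
    simp only [hN_eq, Set.indicator, Set.mem_ofPred_eq, hS h, Pi.one_apply]
  have hshift : ∀ (c : C) y, 2 * (N (wordShift c y) * wordDensity S c y) =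
      (1 + bitSign ((c : Fin n → ZMod 2) i)) * (N y * wordDensity S c y) +
        (1 - bitSign ((c : Fin n → ZMod 2) i)) * (P y * wordDensity S c y) := fun c y => by
    simp only [hN_eq, hP_eq, Set.indicator, Set.mem_ofPred_eq, hT c c.2, Pi.one_apply]
    rcases bitSign_eq_one_or ((c : Fin n → ZMod 2) i) with h | h <;> simp [h, one_add_one_eq_two]
  have hadd : ∀ y, codeDensity C S y + codeAvg C S (fun c => bitSign (c i)) y =
      codeAvg C S (fun c => 1 + bitSign (c i)) y := fun y => by
    simp only [codeDensity, codeAvg, ← Finset.expect_add_distrib, add_mul]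
  have hsub : ∀ y, codeDensity C S y - codeAvg C S (fun c => bitSign (c i)) y =
      codeAvg C S (fun c => 1 - bitSign (c i)) y := fun y => by
    simp only [codeDensity, codeAvg, ← Finset.expect_sub_distrib, sub_mul]
  simp only [hadd, hsub]
  rw [integral_add (BddMeasurable.integrable (by fun_prop) _)
    (BddMeasurable.integrable (by fun_prop) _), integral_mul_codeAvg C ν hN,
    integral_mul_codeAvg C ν hP, ← Finset.expect_add_distrib, ← integral_indicator_one hneg,
    integral_wordLaw_zero_eq_expect C hN hdep, Finset.mul_expect]
  refine Finset.expect_congr rfl fun c _ => ?_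
  simp only [← integral_const_mul, hshift]
  exact integral_add (BddMeasurable.integrable (by fun_prop) _)
    (BddMeasurable.integrable (by fun_prop) _)

lemma IsBitEquivariant.le_two_mul_measureReal_nonpos (hT : IsBitEquivariant C i T)
    (hm : Measurable T) (hS : DependsOn T S) :
    ∫ y, codeDensity C S y - |codeAvg C S (fun c => bitSign (c i)) y| ∂wordBase ν n ≤
      2 * (wordLaw ν 0).real {y | T y ≤ 0} := by
  have hN : BddMeasurable ({y | T y ≤ 0}.indicator 1) := .indicator_one (hm measurableSet_Iic)
  have hP : BddMeasurable ({y | 0 ≤ T y}.indicator 1) := .indicator_one (hm measurableSet_Ici)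
  have habs := (bddMeasurable_codeAvg C S fun c => bitSign (c i)).continuous_comp continuous_abs
  rw [hT.two_mul_measureReal_nonpos hm hS]
  refine integral_mono (BddMeasurable.integrable (by fun_prop) _)
    (BddMeasurable.integrable (by fun_prop) _) fun y => ?_
  have hdensity := abs_codeAvg_bitSign_le C S i y
  have hle := neg_abs_le (codeAvg C S (fun c => bitSign (c i)) y)
  have hle' := le_abs_self (codeAvg C S (fun c => bitSign (c i)) y)
  simp only [Set.indicator, Set.mem_ofPred_eq, Pi.one_apply]
  split_ifs <;> linarith

lemma measureReal_softDecision_nonpos_le :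
    (wordLaw ν 0).real {y | softDecision C S i y ≤ 0} ≤
      ∫ y, codeDensity C S y - |codeAvg C S (fun c => bitSign (c i)) y| ∂wordBase ν n := by
  have hm := (bddMeasurable_softDecision C S i).measurable
  have hN : BddMeasurable ({y | softDecision C S i y ≤ 0}.indicator 1) :=
    .indicator_one (hm measurableSet_Iic)
  have hP : BddMeasurable ({y | 0 ≤ softDecision C S i y}.indicator 1) :=
    .indicator_one (hm measurableSet_Ici)
  have habs := (bddMeasurable_codeAvg C S fun c => bitSign (c i)).continuous_comp continuous_abs
  rw [← mul_le_mul_iff_right₀ two_pos, isBitEquivariant_softDecision.two_mul_measureReal_nonpos hm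
    (dependsOn_softDecision C S i), ← integral_const_mul]
  refine integral_mono (BddMeasurable.integrable (by fun_prop) _)
    (BddMeasurable.integrable (by fun_prop) _) fun y => ?_
  simp only [Set.indicator, Set.mem_ofPred_eq, Pi.one_apply, ← softDecision_mul_codeDensity,
    abs_mul, abs_of_nonneg (codeDensity_nonneg C S y)]
  have hf := codeDensity_nonneg C S y
  have hgf := mul_le_of_le_one_left hf (abs_softDecision_le C S i y)
  rcases lt_trichotomy (softDecision C S i y) 0 with h | h | h
  · rw [abs_of_neg h] at hgf ⊢
    rw [if_pos h.le, if_neg h.not_ge]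
    linarith
  · simp only [h, le_refl, if_true, abs_zero]
    linarith
  · rw [abs_of_pos h] at hgf ⊢
    rw [if_neg h.not_ge, if_pos h.le]
    linarith

end Decoding

section Likelihood

variable {n : ℕ} {C : BinaryCode n} {i : Fin n} {S : Finset (Fin n)}

open Classical in
/-- The codewords with bit `b` at coordinate `i`. -/
def codewordsWithBit (C : BinaryCode n) (i : Fin n) (b : ZMod 2) : Finset (Fin n → ZMod 2) :=
  Finset.univ.filter fun x => x ∈ C ∧ x i = b

lemma mem_codewordsWithBit {b : ZMod 2} {x : Fin n → ZMod 2} :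
    x ∈ codewordsWithBit C i b ↔ x ∈ C ∧ x i = b := by
  simp [codewordsWithBit]

lemma bitLikelihood_eq (y : Fin n → OutputLetter) (b : ZMod 2) :
    bitLikelihood C i S (fun j => y j) b =
      (1 / 2) ^ S.card * ((∑ x ∈ codewordsWithBit C i b, wordDensity S x y) /
        (codewordsWithBit C i b).card) := by
  have hprod : ∀ x : Fin n → ZMod 2,
      ∏ j : S, flipProb (y j).1 ((y j).2 - x j) = (1 / 2) ^ S.card * wordDensity S x y := by
    intro x
    rw [Finset.prod_coe_sort S fun j => flipProb (y j).1 ((y j).2 - x j), wordDensity,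
      ← Finset.prod_const, ← Finset.prod_mul_distrib]
    simp only [flipProb_sub, div_eq_inv_mul, mul_one]
  simp only [bitLikelihood, codewordsWithBit, hprod, ← Finset.mul_sum, mul_div_assoc]

lemma card_codewordsWithBit_le {b b' : ZMod 2} (h : (codewordsWithBit C i b).Nonempty)
    (h' : (codewordsWithBit C i b').Nonempty) :
    (codewordsWithBit C i b).card ≤ (codewordsWithBit C i b').card := by
  obtain ⟨⟨x, hx⟩, ⟨z, hz⟩⟩ := And.intro h h'
  rw [mem_codewordsWithBit] at hx hz
  refine Finset.card_le_card_of_injOn (fun c => c + (z - x)) (fun c hc => ?_)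
    (add_left_injective _).injOn
  rw [Finset.mem_coe, mem_codewordsWithBit] at hc ⊢
  exact ⟨C.add_mem hc.1 (C.sub_mem hz.1 hx.1), by simp [hc.2, hx.2, hz.2]⟩

lemma sum_codewordsWithBit (b : ZMod 2) (φ : (Fin n → ZMod 2) → ℝ) :
    ∑ x ∈ codewordsWithBit C i b, φ x =
      ∑ c : C, if (c : Fin n → ZMod 2) i = b then φ c else 0 := by
  classical
  rw [codewordsWithBit, ← Finset.filter_filter, Finset.sum_filter,
    Finset.sum_subtype (p := (· ∈ C)) _ (by simp)]

lemma card_mul_bitSign_mul_codeAvg {b b' : ZMod 2} (hb : b ≠ b') (y : Fin n → OutputLetter) :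
    Fintype.card C * (bitSign b * codeAvg C S (fun c => bitSign (c i)) y) =
      ∑ x ∈ codewordsWithBit C i b, wordDensity S x y -
        ∑ x ∈ codewordsWithBit C i b', wordDensity S x y := by
  rw [codeAvg, Fintype.expect_eq_sum_div_card, mul_left_comm,
    mul_div_cancel₀ _ (by exact_mod_cast Fintype.card_ne_zero), Finset.mul_sum,
    sum_codewordsWithBit, sum_codewordsWithBit, ← Finset.sum_sub_distrib]
  refine Finset.sum_congr rfl fun c _ => ?_
  rcases zmod_two_cases b with rfl | rfl <;> rcases zmod_two_cases b' with rfl | rfl <;>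
    rcases zmod_two_cases ((c : Fin n → ZMod 2) i) with h | h <;>
    simp_all [bitSign_one]

lemma IsMLDecoder.bitSign_mul_softDecision_nonpos {D : BitDecoder S} (hD : IsMLDecoder C i S D)
    {x : Fin n → ZMod 2} (hx : x ∈ C) {y : Fin n → OutputLetter}
    (hy : D (fun j => y j) ≠ x i) : bitSign (x i) * softDecision C S i y ≤ 0 := by
  set b := x i with hb
  set b' := D fun j => y j
  have hxb : x ∈ codewordsWithBit C i b := mem_codewordsWithBit.2 ⟨hx, hb.symm⟩
  have hcard : (0 : ℝ) < (codewordsWithBit C i b).card := by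
    exact_mod_cast Finset.card_pos.2 ⟨x, hxb⟩
  have hmax := hD.maximal (fun j => y j) b
  rw [bitLikelihood_eq, bitLikelihood_eq, mul_le_mul_iff_right₀ (by positivity)] at hmax
  have hle : ∑ x ∈ codewordsWithBit C i b, wordDensity S x y ≤
      ∑ x ∈ codewordsWithBit C i b', wordDensity S x y := by
    rcases (codewordsWithBit C i b').eq_empty_or_nonempty with h | h
    · rw [h, Finset.sum_empty, zero_div, div_le_iff₀ hcard, zero_mul] at hmax
      rwa [h, Finset.sum_empty]
    · rwa [(card_codewordsWithBit_le ⟨x, hxb⟩ h).antisymm (card_codewordsWithBit_le h ⟨x, hxb⟩),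
        div_le_div_iff_of_pos_right (by exact_mod_cast h.card_pos)] at hmax
  have hsign : bitSign b * codeAvg C S (fun c => bitSign (c i)) y ≤ 0 := by
    have hpos : (0 : ℝ) < Fintype.card C := by exact_mod_cast Fintype.card_pos
    refine nonpos_of_mul_nonpos_right (a := (Fintype.card C : ℝ)) ?_ hpos
    rw [card_mul_bitSign_mul_codeAvg hy.symm]
    exact sub_nonpos.2 hle
  rw [softDecision, ← mul_div_assoc]
  exact div_nonpos_of_nonpos_of_nonneg hsign (codeDensity_nonneg C S y)

variable (ν : Measure Crossover) [IsProbabilityMeasure ν]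

lemma IsMLDecoder.decodingError_le {D : BitDecoder S} (hD : IsMLDecoder C i S D)
    {x : Fin n → ZMod 2} (hx : x ∈ C) {T : (Fin n → OutputLetter) → ℝ}
    (hT : IsBitEquivariant C i T) (hm : Measurable T) (hS : DependsOn T S) :
    decodingError ν x i S D ≤ 2 * (wordLaw ν 0).real {y | T y ≤ 0} := by
  have hshift : MeasurePreserving (wordShift x) (wordLaw ν 0) (wordLaw ν x) := by
    simpa using measurePreserving_wordShift_wordLaw (ν := ν) x 0
  calc decodingError ν x i S D
      ≤ (wordLaw ν x).real {y | bitSign (x i) * softDecision C S i y ≤ 0} :=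
        measureReal_mono fun y hy => hD.bitSign_mul_softDecision_nonpos hx hy
    _ = (wordLaw ν 0).real {y | softDecision C S i y ≤ 0} := by
        rw [measureReal_def, ← hshift.measure_preimage_equiv, ← measureReal_def]
        simp only [Set.preimage, Set.mem_ofPred_eq, isBitEquivariant_softDecision x hx,
          ← mul_assoc, bitSign_mul_self, one_mul]
    _ ≤ _ := measureReal_softDecision_nonpos_le.trans (hT.le_two_mul_measureReal_nonpos hm hS)

end Likelihood

section Symmetry

variable {n : ℕ} {C : BinaryCode n} {σ : Equiv.Perm (Fin n)}

lemma IsCodeSymmetry.codeAvg_map (hσ : IsCodeSymmetry C σ) (S : Finset (Fin n))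
    (φ : (Fin n → ZMod 2) → ℝ) (y : Fin n → OutputLetter) :
    codeAvg C (S.map σ.toEmbedding) (fun c => φ (c ∘ σ)) y = codeAvg C S φ (y ∘ σ) := by
  refine Fintype.expect_equiv
    ((σ.symm.arrowCongr (.refl _)).subtypeEquiv fun x => (hσ x).symm) _ _ fun c => ?_
  simp only [wordDensity, Finset.prod_map]
  rfl

lemma IsCodeSymmetry.decisionEnergy_map (hσ : IsCodeSymmetry C σ) (ν : Measure Crossover)
    [IsProbabilityMeasure ν] (S : Finset (Fin n)) (i : Fin n) :
    decisionEnergy C ν (S.map σ.toEmbedding) (σ i) = decisionEnergy C ν S i := by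
  have hdensity : ∀ y, codeDensity C (S.map σ.toEmbedding) y = codeDensity C S (y ∘ σ) :=
    hσ.codeAvg_map S fun _ => 1
  have hsoft : ∀ y, softDecision C (S.map σ.toEmbedding) (σ i) y = softDecision C S i (y ∘ σ) :=
    fun y => congrArg₂ _ (hσ.codeAvg_map S (fun c => bitSign (c i)) y) (hdensity y)
  simp only [decisionEnergy, hdensity, hsoft]
  exact (measurePreserving_comp_perm_wordBase ν σ).integral_comp'
    (f := .arrowCongr' σ.symm (.refl OutputLetter))
    fun y => softDecision C S i y ^ 2 * codeDensity C S y

end Symmetry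

section Petals

variable {n : ℕ} {C : BinaryCode n} {petals : Finset (Finset (Fin n))}

/-- The sum, over the petals through `i`, of the soft decisions on bit `i` from the other outputs
on the petal. -/
def petalVote (C : BinaryCode n) (petals : Finset (Finset (Fin n))) (i : Fin n)
    (y : Fin n → OutputLetter) : ℝ :=
  ∑ P ∈ petals with i ∈ P, softDecision C (P.erase i) i y

lemma bddMeasurable_petalVote (i : Fin n) : BddMeasurable (petalVote C petals i) :=
  .sum _ fun P => bddMeasurable_softDecision C (P.erase i) i

lemma dependsOn_petalVote (i : Fin n) :
    DependsOn (petalVote C petals i) ({i}ᶜ : Finset (Fin n)) := fun y y' h =>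
  Finset.sum_congr rfl fun P _ => dependsOn_softDecision C (P.erase i) i fun j hj =>
    h j (by simpa using Finset.ne_of_mem_erase (Finset.mem_coe.1 hj))

lemma isBitEquivariant_petalVote (i : Fin n) : IsBitEquivariant C i (petalVote C petals i) :=
  .sum fun _ => isBitEquivariant_softDecision

variable (ν : Measure Crossover) [IsProbabilityMeasure ν]

lemma card_mul_sub_restrictRate_le_sum_decisionEnergy (P : Finset (Fin n)) :
    P.card * ((capacity ν - restrictRate C P) * Real.log 2) ≤
      ∑ i ∈ P, decisionEnergy C ν (P.erase i) i := by
  rcases P.eq_empty_or_nonempty with rfl | hP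
  · simp
  have hcard : (P.card : ℝ) ≠ 0 := by exact_mod_cast hP.card_pos.ne'
  calc P.card * ((capacity ν - restrictRate C P) * Real.log 2)
      = P.card * (capacity ν * Real.log 2) -
          Module.finrank (ZMod 2) (codeRestrict C P) * Real.log 2 := by
        rw [restrictRate]; field_simp
    _ ≤ P.card * fairInfo ν - Module.finrank (ZMod 2) (codeRestrict C P) * Real.log 2 := by
        gcongr
        exact capacity_mul_log_two_le ν
    _ ≤ _ := (le_blockInfo C ν P).trans (blockInfo_le_sum_decisionEnergy C ν P)

lemma le_integral_petalVote (htrans : ∀ i j : Fin n, ∃ σ, IsCodeSymmetry C σ ∧ σ i = j)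
    (hinv : ∀ P ∈ petals, ∀ σ, IsCodeSymmetry C σ → P.map σ.toEmbedding ∈ petals) {γ : ℝ}
    (hrate : ∀ P ∈ petals, restrictRate C P ≤ capacity ν - γ) (i : Fin n) :
    (petals.filter fun P => i ∈ P).card * (γ * Real.log 2) ≤
      ∫ y, petalVote C petals i y ∂wordLaw ν 0 := by
  have hpetal : ∀ P ∈ petals,
      0 ≤ ∑ i ∈ P, (decisionEnergy C ν (P.erase i) i - γ * Real.log 2) := fun P hP => by
    have hgap : P.card * (γ * Real.log 2) ≤
        P.card * ((capacity ν - restrictRate C P) * Real.log 2) := by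
      gcongr
      linarith [hrate P hP]
    rw [Finset.sum_sub_distrib, Finset.sum_const, nsmul_eq_mul]
    linarith [card_mul_sub_restrictRate_le_sum_decisionEnergy (C := C) ν P]
  have hthrough := sum_filter_mem_nonneg_of_transitive (fun i j => by
    obtain ⟨σ, hσ, rfl⟩ := htrans i j
    refine ⟨σ, rfl, fun P hP => ⟨hinv P hP σ hσ, ?_⟩⟩
    rw [← hσ.decisionEnergy_map ν (P.erase i) i, Finset.map_erase]
    rfl) hpetal i
  simp only [petalVote]
  rw [integral_finsetSum _ fun P _ => BddMeasurable.integrable (by fun_prop) _]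
  simp only [integral_softDecision]
  rwa [Finset.sum_sub_distrib, Finset.sum_const, nsmul_eq_mul, sub_nonneg] at hthrough

open ProbabilityTheory in
lemma variance_petalVote_le {ρ : ℝ} (hρ : 0 ≤ ρ) (i : Fin n)
    (hcorr : ∀ j, i ≠ j → ((petals.filter fun P => i ∈ P ∧ j ∈ P).card : ℝ) ≤
      ρ * (petals.filter fun P => i ∈ P).card) :
    Var[petalVote C petals i; wordLaw ν 0] ≤
      ρ * (petals.filter fun P => i ∈ P).card ^ 2 := by
  have hcount : ∀ j,
      (((petals.filter fun P => i ∈ P).filter fun P => j ∈ P.erase i).card : ℝ) ≤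
        ρ * (petals.filter fun P => i ∈ P).card := fun j => by
    rcases eq_or_ne i j with rfl | hij
    · simp only [Finset.notMem_erase, Finset.filter_false, Finset.card_empty, Nat.cast_zero]
      positivity
    · simpa only [Finset.filter_filter, Finset.mem_erase, hij.symm, ne_eq, not_false_iff,
        true_and] using hcorr j hij
  have hvar : ∀ P : Finset (Fin n), Var[softDecision C (P.erase i) i; wordLaw ν 0] ≤ 1 := by
    intro P
    have h := variance_le_sq_of_bounded (μ := wordLaw ν 0)
      (.of_forall fun y => abs_le.1 (abs_softDecision_le C (P.erase i) i y))
      (bddMeasurable_softDecision C _ i).measurable.aemeasurable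
    norm_num at h
    exact h
  calc Var[petalVote C petals i; wordLaw ν 0]
      ≤ ρ * (petals.filter fun P => i ∈ P).card *
        ∑ P ∈ petals with i ∈ P, Var[softDecision C (P.erase i) i; wordLaw ν 0] :=
        variance_sum_le (fun P => bddMeasurable_softDecision C (P.erase i) i)
          (fun P => dependsOn_softDecision C (P.erase i) i) hcount
    _ ≤ ρ * (petals.filter fun P => i ∈ P).card * ∑ P ∈ petals with i ∈ P, 1 := by
        gcongr
        exact hvar _
    _ = _ := by rw [Finset.sum_const, nsmul_one, sq, mul_assoc]

end Petals

section Camellia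

variable {n : ℕ} {C : BinaryCode n} {δ ρ γ : ℝ} (ν : Measure Crossover) [IsProbabilityMeasure ν]

lemma IsCamelliaCode.exists_measureReal_petalVote_nonpos_le (hC : IsCamelliaCode C δ ρ)
    (hγ : 0 < γ) (hδ : δ ≤ capacity ν - codeRate C - γ) :
    ∃ petals, ∀ i, (wordLaw ν 0).real {y | petalVote C petals i y ≤ 0} ≤
      max ρ 0 / (γ * Real.log 2) ^ 2 := by
  obtain ⟨petals, hcover, hinv, hrate, hcorr⟩ := hC.petals
  refine ⟨petals, fun i => ?_⟩
  set A := petals.filter fun P => i ∈ P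
  have hcard : (0 : ℝ) < A.card := by
    obtain ⟨P, hP, hi⟩ := hcover i
    exact_mod_cast Finset.card_pos.2 ⟨P, Finset.mem_filter.2 ⟨hP, hi⟩⟩
  have hmean := le_integral_petalVote ν (γ := γ) hC.transitive hinv
    (fun P hP => (hrate P hP).trans (by linarith)) i
  have hvar := variance_petalVote_le (C := C) ν (le_max_right ρ 0) i fun j hij =>
    (div_le_iff₀ hcard).1 ((hcorr i j hij).trans (le_max_left ρ 0))
  calc (wordLaw ν 0).real {y | petalVote C petals i y ≤ 0}
      ≤ _ := measureReal_nonpos_le_variance_div_sq ((bddMeasurable_petalVote i).memLp 2 _)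
        (by positivity) hmean
    _ ≤ max ρ 0 * A.card ^ 2 / (A.card * (γ * Real.log 2)) ^ 2 := by gcongr
    _ = max ρ 0 / (γ * Real.log 2) ^ 2 := by
        rw [mul_pow, mul_comm (max ρ 0), mul_div_mul_left _ _ (by positivity)]

lemma IsCamelliaCode.decodingError_le (hC : IsCamelliaCode C δ ρ) (hγ : 0 < γ)
    (hδ : δ ≤ capacity ν - codeRate C - γ) {x : Fin n → ZMod 2} (hx : x ∈ C) {i : Fin n}
    {S : Finset (Fin n)} (hS : {i}ᶜ ⊆ S) {D : BitDecoder S} (hD : IsMLDecoder C i S D) :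
    decodingError ν x i S D ≤ 2 / (γ * Real.log 2) ^ 2 * max ρ 0 := by
  obtain ⟨petals, hvote⟩ := hC.exists_measureReal_petalVote_nonpos_le ν hγ hδ
  rw [div_mul_comm, mul_comm]
  refine (hD.decodingError_le ν hx (isBitEquivariant_petalVote i)
    (bddMeasurable_petalVote i).measurable ?_).trans
    (mul_le_mul_of_nonneg_left (hvote i) zero_le_two)
  exact fun y y' h => dependsOn_petalVote i fun j hj => h j (hS hj)

end Camellia

lemma max_zero_le_sqrt {t : ℝ} (ht : t ≤ 1) : max t 0 ≤ √t := by
  rcases le_total t 0 with h | h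
  · rw [max_eq_right h]; exact Real.sqrt_nonneg t
  · rw [max_eq_left h]; exact Real.le_sqrt_of_sq_le (by nlinarith)

section Errors

variable {n : ℕ} {C : BinaryCode n} {δ ρ γ : ℝ} {x : Fin n → ZMod 2} (ν : Measure Crossover)
  {Dloc : ∀ i : Fin n, BitDecoder ({i}ᶜ : Finset (Fin n))}
  {Dbit : Fin n → BitDecoder (Finset.univ : Finset (Fin n))}

lemma localError_nonneg : 0 ≤ localError ν x Dloc :=
  Real.iSup_nonneg fun _ => measureReal_nonneg

lemma bitError_nonneg : 0 ≤ bitError ν x Dbit :=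
  Real.iSup_nonneg fun _ => measureReal_nonneg

variable [IsProbabilityMeasure ν]

lemma IsCamelliaCode.localError_le (hC : IsCamelliaCode C δ ρ) (hγ : 0 < γ)
    (hδ : δ ≤ capacity ν - codeRate C - γ) (hx : x ∈ C)
    (hD : ∀ i, IsMLDecoder C i {i}ᶜ (Dloc i)) :
    localError ν x Dloc ≤ 2 / (γ * Real.log 2) ^ 2 * max ρ 0 :=
  Real.iSup_le (fun i => hC.decodingError_le ν hγ hδ hx subset_rfl (hD i)) (by positivity)

lemma IsCamelliaCode.bitError_le (hC : IsCamelliaCode C δ ρ) (hγ : 0 < γ)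
    (hδ : δ ≤ capacity ν - codeRate C - γ) (hx : x ∈ C)
    (hD : ∀ i, IsMLDecoder C i Finset.univ (Dbit i)) :
    bitError ν x Dbit ≤ 2 / (γ * Real.log 2) ^ 2 * max ρ 0 :=
  Real.iSup_le (fun i => hC.decodingError_le ν hγ hδ hx (Finset.subset_univ _) (hD i))
    (by positivity)

end Errors

end

theorem theorem1 (ν : Measure Crossover) [IsProbabilityMeasure ν]
    (N : ℕ → ℕ) (C : ∀ k, BinaryCode (N k)) (δ ρ : ℕ → ℝ)
    (hC : ∀ k, IsCamelliaCode (C k) (δ k) (ρ k))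
    (hδ : ∃ γ : ℝ, 0 < γ ∧ ∀ᶠ k in atTop, δ k ≤ capacity ν - codeRate (C k) - γ)
    (hρ : Tendsto ρ atTop (𝓝 0))
    (x : ∀ k, Fin (N k) → ZMod 2) (hx : ∀ k, x k ∈ C k)
    (Dloc : ∀ k (i : Fin (N k)), BitDecoder ({i}ᶜ : Finset (Fin (N k))))
    (hDloc : ∀ k i, IsMLDecoder (C k) i {i}ᶜ (Dloc k i))
    (Dbit : ∀ k, Fin (N k) → BitDecoder (Finset.univ : Finset (Fin (N k))))
    (hDbit : ∀ k i, IsMLDecoder (C k) i Finset.univ (Dbit k i)) :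
    (fun k => localError ν (x k) (Dloc k)) =O[atTop] (fun k => √(ρ k)) ∧
      Tendsto (fun k => localError ν (x k) (Dloc k)) atTop (𝓝 0) ∧
      Tendsto (fun k => bitError ν (x k) (Dbit k)) atTop (𝓝 0) := by
  obtain ⟨γ, hγ, hgap⟩ := hδ
  set K : ℝ := 2 / (γ * Real.log 2) ^ 2
  have hloc : ∀ᶠ k in atTop, localError ν (x k) (Dloc k) ≤ K * max (ρ k) 0 :=
    hgap.mono fun k hk => (hC k).localError_le ν hγ hk (hx k) (hDloc k)
  have hbit : ∀ᶠ k in atTop, bitError ν (x k) (Dbit k) ≤ K * max (ρ k) 0 :=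
    hgap.mono fun k hk => (hC k).bitError_le ν hγ hk (hx k) (hDbit k)
  have hlim : Tendsto (fun k => K * max (ρ k) 0) atTop (𝓝 0) := by
    simpa using (hρ.max (tendsto_const_nhds (x := (0 : ℝ)))).const_mul K
  refine ⟨IsBigO.of_bound K ?_, squeeze_zero' (.of_forall fun k => localError_nonneg ν) hloc hlim,
    squeeze_zero' (.of_forall fun k => bitError_nonneg ν) hbit hlim⟩
  filter_upwards [hloc, hρ.eventually_le_const zero_lt_one] with k hk hρk
  rw [Real.norm_of_nonneg (localError_nonneg ν), Real.norm_of_nonneg (Real.sqrt_nonneg _)]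
  exact hk.trans (mul_le_mul_of_nonneg_left (max_zero_le_sqrt hρk) (by positivity))
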